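/- **Conventions.** A unary monoid is a monoid $M$ with a unary operation $m\mapsto m^+$; morphisms preserve the identity, the product and $^+$. It is left adequate if it satisfies $x^+x\approx x$, $(x^+y^+)^+\approx x^+y^+\approx y^+x^+$, $(xy)^+\approx(xy^+)^+$, $x^2\approx x\to x\approx x^+$ and $xz\approx yz\to xz^+\approx yz^+$. Let $\mathrm{FLAd}(a)$ be the left adequate monoid freely generated by one element $a$, let $\Sigma$ be a set, let $\mathrm F(\Sigma)$ be the free monoid on $\Sigma$ and let $\mathrm F_u(\Sigma)$ be the free unary monoid on $\Sigma$ (only the monoid laws are imposed). For $s,t\in\mathrm F_u(\Sigma)$, $\mathrm{FLAd}(a)$ satisfies $s\approx t$ if $\phi(s)=\phi(t)$ for every morphism of unary monoids $\phi:\mathrm F_u(\Sigma)\to\mathrm{FLAd}(a)$. A non-nested word is an element of the free monoid $\mathrm F(\overline\Sigma)$ on $\overline\Sigma=\Sigma\cup\{w^+ : w\in\mathrm F(\Sigma)\}$, regarded as an element of $\mathrm F_u(\Sigma)$. For a word $u$, $|u|_x$ is the number of occurrences of the symbol $x$ in $u$, $\mathrm{supp}(u)$ is the set of symbols occurring in $u$,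 and $\mathrm{mp}_u(x)$ is the longest prefix of $u$ ending in $x$ (empty if $x$ does not occur in $u$). For $u\in\mathrm F(\overline\Sigma)$, $\overline u\in\mathrm F(\Sigma)$ is obtained from $u$ by deleting all symbols $w^+$. In a non-nested word each $w^+$ is a single symbol, so its inner letters are not counted in $|u|_y$ for $y\in\Sigma$. For $x\in\mathrm{supp}(u)$, $\mathrm{suff}_u(x)$ is the shortest suffix of $u$ containing $x$ if $x\in\Sigma$, and the longest suffix of $u$ in which no element of $\Sigma$ lies to the left of any copy of $x$ if $x=w^+$. For $w^+\in\mathrm{supp}(u)$ and $x\in\mathrm{supp}(w)$ put $s=\mathrm{suff}_u(w^+)$ and $$P^u_{w,x}=\{\overline{\mathrm{mp}_s(k^+)}\cdot k^+ : k^+\in\mathrm{supp}(s),\ x\in\mathrm{supp}(k)\},$$ $$Q^u_{w,x}=P^u_{w,x}\ \text{ if } x\notin\mathrm{supp}(s),\qquad Q^u_{w,x}=P^u_{w,x}\cup\{\overline s\cdot\varepsilon^+\}\ \text{ if } x\in\mathrm{supp}(s),$$ $$R^u_{w,x}=Q^u_{w,x}\setminus\{k^+ : |\mathrm{mp}_w(x)|_y=|\mathrm{mp}_k(x)|_y\text{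 for all }y\in\Sigma\}.$$ **Theorem.** Let $u,v\in\mathrm F(\overline\Sigma)$ be non-nested words. Then $\mathrm{FLAd}(a)$ satisfies $u\approx v$ if and only if all of the following hold. (i) $|u|_x=|v|_x$ for all $x\in\Sigma$. (ii) For all $x\in\mathrm{supp}(u)\cap\Sigma$, either (a) there is $w^+\in\mathrm{supp}(\mathrm{suff}_u(x))$ with $x\in\mathrm{supp}(w)$, or (b) $|\mathrm{suff}_u(x)|_y=|\mathrm{suff}_v(x)|_y$ for all $y\in\Sigma$. (iii) For all $w^+\in\mathrm{supp}(u)$ and $x\in\mathrm{supp}(w)$, either (a) for every monoid morphism $\psi:\mathrm F(\Sigma)\to(\mathbb N,+)$, where $0\in\mathbb N$, there is $pk^+\in R^u_{w,x}$ (with $p,k\in\mathrm F(\Sigma)$) such that $\psi(\mathrm{mp}_w(x))\le\psi(\mathrm{mp}_{pk}(x))$, or (b) there is $h^+\in\mathrm{supp}(v)$ with $|\mathrm{suff}_u(w^+)|_y=|\mathrm{suff}_v(h^+)|_y$ and $|\mathrm{mp}_w(x)|_y=|\mathrm{mp}_h(x)|_y$ for all $y\in\Sigma$. (iv) The statement (iii)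 with $u$ and $v$ interchanged. Moreover, for every $s\in\mathrm F_u(\Sigma)$ there is a non-nested word $u$ such that $\mathrm{FLAd}(a)$ satisfies $s\approx u$; hence the above classifies all identities over $\Sigma$ satisfied by $\mathrm{FLAd}(a)$. -/

import Mathlib

/-! ## Unary monoids and left adequate monoids -/

/-- A unary monoid: an algebra of signature `(2,1,0)` whose `(2,0)`-reduct is a monoid.
The unary operation `m ↦ m⁺` is written `plus m`; it is subject to no law. -/
class UnaryMonoid (M : Type*) extends Monoid M where
  /-- the unary operation -/
  plus : M → M

/-- Morphisms of unary monoids: they preserve the identity, the product and the operation `⁺`. -/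
structure UnaryMonoidHom (M N : Type*) [UnaryMonoid M] [UnaryMonoid N] extends M →* N where
  map_plus' : ∀ m : M, toFun (UnaryMonoid.plus m) = UnaryMonoid.plus (toFun m)

instance (M N : Type*) [UnaryMonoid M] [UnaryMonoid N] : FunLike (UnaryMonoidHom M N) M N where
  coe φ := φ.toFun
  coe_injective φ ψ h := by
    obtain ⟨φ, _⟩ := φ
    obtain ⟨ψ, _⟩ := ψ
    have : φ = ψ := MonoidHom.ext fun x => congrFun h x
    subst this
    rfl

/-- A unary monoid is left adequate if it satisfies the defining quasi-identities
`x⁺x ≈ x`, `(x⁺y⁺)⁺ ≈ x⁺y⁺ ≈ y⁺x⁺`, `(xy)⁺ ≈ (xy⁺)⁺`, `x² ≈ x → x ≈ x⁺` and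
`xz ≈ yz → xz⁺ ≈ yz⁺`. -/
class IsLeftAdequate (M : Type*) [UnaryMonoid M] : Prop where
  plus_mul_self : ∀ x : M, UnaryMonoid.plus x * x = x
  plus_plus_mul_plus : ∀ x y : M,
    UnaryMonoid.plus (UnaryMonoid.plus x * UnaryMonoid.plus y) =
      UnaryMonoid.plus x * UnaryMonoid.plus y
  plus_mul_comm : ∀ x y : M,
    UnaryMonoid.plus x * UnaryMonoid.plus y = UnaryMonoid.plus y * UnaryMonoid.plus x
  plus_mul : ∀ x y : M, UnaryMonoid.plus (x * y) = UnaryMonoid.plus (x * UnaryMonoid.plus y)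
  eq_plus_of_mul_self : ∀ x : M, x * x = x → x = UnaryMonoid.plus x
  mul_plus_eq_of_mul_eq : ∀ x y z : M, x * z = y * z →
    x * UnaryMonoid.plus z = y * UnaryMonoid.plus z

/-! ## The free unary monoid -/

/-- Terms of signature `(2,1,0)` over the alphabet `X`. -/
inductive UnaryTerm (X : Type*) where
  | var : X → UnaryTerm X
  | one : UnaryTerm X
  | mul : UnaryTerm X → UnaryTerm X → UnaryTerm X
  | plus : UnaryTerm X → UnaryTerm X

/-- The congruence on terms generated by the monoid laws alone. -/
inductive UnaryTerm.Rel {X : Type*} : UnaryTerm X → UnaryTerm X → Prop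
  | refl (s) : Rel s s
  | symm {s t} : Rel s t → Rel t s
  | trans {s t r} : Rel s t → Rel t r → Rel s r
  | mul {s s' t t'} : Rel s s' → Rel t t' → Rel (.mul s t) (.mul s' t')
  | plus {s s'} : Rel s s' → Rel (.plus s) (.plus s')
  | assoc (s t r) : Rel (.mul (.mul s t) r) (.mul s (.mul t r))
  | one_mul (s) : Rel (.mul .one s) s
  | mul_one (s) : Rel (.mul s .one) s

/-- The setoid of the congruence generated by the monoid laws. -/
def UnaryTerm.setoid (X : Type*) : Setoid (UnaryTerm X) where
  r := UnaryTerm.Rel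
  iseqv := ⟨.refl, .symm, .trans⟩

/-- The free unary monoid on `X`: terms modulo the monoid laws. -/
def FreeUnaryMonoid (X : Type*) : Type _ := Quotient (UnaryTerm.setoid X)

namespace FreeUnaryMonoid

instance (X : Type*) : UnaryMonoid (FreeUnaryMonoid X) where
  one := Quotient.mk (UnaryTerm.setoid X) .one
  mul := Quotient.map₂ UnaryTerm.mul fun _ _ h _ _ h' => UnaryTerm.Rel.mul h h'
  plus := Quotient.map UnaryTerm.plus fun _ _ h => UnaryTerm.Rel.plus h
  mul_assoc := by
    rintro ⟨x⟩ ⟨y⟩ ⟨z⟩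
    exact Quotient.sound (UnaryTerm.Rel.assoc x y z)
  one_mul := by
    rintro ⟨x⟩
    exact Quotient.sound (UnaryTerm.Rel.one_mul x)
  mul_one := by
    rintro ⟨x⟩
    exact Quotient.sound (UnaryTerm.Rel.mul_one x)

/-- The free generators. -/
def of {X : Type*} (x : X) : FreeUnaryMonoid X := Quotient.mk (UnaryTerm.setoid X) (.var x)

/-- Induction on the way an element is built from generators. -/
theorem induction {X : Type*} {p : FreeUnaryMonoid X → Prop} (var : ∀ x, p (of x)) (one : p 1)
    (mul : ∀ s t, p s → p t → p (s * t)) (plus : ∀ s, p s → p (UnaryMonoid.plus s))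
    (s : FreeUnaryMonoid X) : p s := by
  obtain ⟨s⟩ := s
  induction s with
  | var x => exact var x
  | one => exact one
  | mul s t hs ht => exact mul _ _ hs ht
  | plus s hs => exact plus _ hs

/-- The value of a term in a unary monoid. -/
def termValue {X M : Type*} [UnaryMonoid M] (f : X → M) : UnaryTerm X → M
  | .var x => f x
  | .one => 1
  | .mul s t => termValue f s * termValue f t
  | .plus s => UnaryMonoid.plus (termValue f s)

theorem termValue_eq {X M : Type*} [UnaryMonoid M] (f : X → M) {s t : UnaryTerm X}
    (h : UnaryTerm.Rel s t) : termValue f s = termValue f t := by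
  induction h with
  | refl => rfl
  | symm _ ih => exact ih.symm
  | trans _ _ ih ih' => exact ih.trans ih'
  | mul _ _ ih ih' => simp only [termValue, ih, ih']
  | plus _ ih => simp only [termValue, ih]
  | assoc => simp only [termValue, mul_assoc]
  | one_mul => simp only [termValue, one_mul]
  | mul_one => simp only [termValue, mul_one]

/-- The morphism that extends a map on the generators. -/
def lift {X M : Type*} [UnaryMonoid M] (f : X → M) : UnaryMonoidHom (FreeUnaryMonoid X) M where
  toFun := Quotient.lift (termValue f) fun _ _ h => termValue_eq f h
  map_one' := rfl
  map_mul' := by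
    rintro ⟨x⟩ ⟨y⟩
    rfl
  map_plus' := by
    rintro ⟨x⟩
    rfl

theorem lift_of {X M : Type*} [UnaryMonoid M] (f : X → M) (x : X) : lift f (of x) = f x := rfl

/-- The universal property of the free unary monoid. -/
theorem existsUnique_lift {X M : Type*} [UnaryMonoid M] (f : X → M) :
    ∃! φ : UnaryMonoidHom (FreeUnaryMonoid X) M, ∀ x, φ (of x) = f x := by
  refine ⟨lift f, lift_of f, fun φ hφ => DFunLike.ext _ _ fun s => ?_⟩
  induction s using induction with
  | var x => exact (hφ x).trans (lift_of f x).symm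
  | one => exact (φ.map_one').trans (lift f).map_one'.symm
  | mul s t hs ht =>
    exact (φ.map_mul' s t).trans
      ((congrArg₂ (· * ·) hs ht).trans ((lift f).map_mul' s t).symm)
  | plus s hs =>
    exact (φ.map_plus' s).trans
      ((congrArg UnaryMonoid.plus hs).trans ((lift f).map_plus' s).symm)

end FreeUnaryMonoid

/-! ## The free left adequate monoid -/

/-- The least congruence on the free unary monoid whose quotient is left adequate. -/
inductive LeftAdequateRel {X : Type*} : FreeUnaryMonoid X → FreeUnaryMonoid X → Prop
  | refl (s) : LeftAdequateRel s s
  | symm {s t} : LeftAdequateRel s t → LeftAdequateRel t s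
  | trans {s t r} : LeftAdequateRel s t → LeftAdequateRel t r → LeftAdequateRel s r
  | mul {s s' t t'} : LeftAdequateRel s s' → LeftAdequateRel t t' →
      LeftAdequateRel (s * t) (s' * t')
  | plus {s s'} : LeftAdequateRel s s' →
      LeftAdequateRel (UnaryMonoid.plus s) (UnaryMonoid.plus s')
  | plus_mul_self (s) : LeftAdequateRel (UnaryMonoid.plus s * s) s
  | plus_plus_mul_plus (s t) :
      LeftAdequateRel (UnaryMonoid.plus (UnaryMonoid.plus s * UnaryMonoid.plus t))
        (UnaryMonoid.plus s * UnaryMonoid.plus t)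
  | plus_mul_comm (s t) :
      LeftAdequateRel (UnaryMonoid.plus s * UnaryMonoid.plus t)
        (UnaryMonoid.plus t * UnaryMonoid.plus s)
  | plus_mul (s t) :
      LeftAdequateRel (UnaryMonoid.plus (s * t)) (UnaryMonoid.plus (s * UnaryMonoid.plus t))
  | eq_plus_of_mul_self (s) : LeftAdequateRel (s * s) s → LeftAdequateRel s (UnaryMonoid.plus s)
  | mul_plus_eq_of_mul_eq (s t r) : LeftAdequateRel (s * r) (t * r) →
      LeftAdequateRel (s * UnaryMonoid.plus r) (t * UnaryMonoid.plus r)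

/-- The setoid of `LeftAdequateRel`. -/
def LeftAdequateRel.setoid (X : Type*) : Setoid (FreeUnaryMonoid X) where
  r := LeftAdequateRel
  iseqv := ⟨.refl, .symm, .trans⟩

/-- The free left adequate monoid `FLAd(X)`. -/
def FLAd (X : Type*) : Type _ := Quotient (LeftAdequateRel.setoid X)

namespace FLAd

instance (X : Type*) : UnaryMonoid (FLAd X) where
  one := Quotient.mk (LeftAdequateRel.setoid X) 1
  mul := Quotient.map₂ (· * ·) fun _ _ h _ _ h' => LeftAdequateRel.mul h h'
  plus := Quotient.map UnaryMonoid.plus fun _ _ h => LeftAdequateRel.plus h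
  mul_assoc := by
    rintro ⟨x⟩ ⟨y⟩ ⟨z⟩
    exact congrArg (Quotient.mk (LeftAdequateRel.setoid X)) (mul_assoc x y z)
  one_mul := by
    rintro ⟨x⟩
    exact congrArg (Quotient.mk (LeftAdequateRel.setoid X)) (one_mul x)
  mul_one := by
    rintro ⟨x⟩
    exact congrArg (Quotient.mk (LeftAdequateRel.setoid X)) (mul_one x)

instance (X : Type*) : IsLeftAdequate (FLAd X) where
  plus_mul_self := by
    rintro ⟨x⟩
    exact Quotient.sound (LeftAdequateRel.plus_mul_self x)
  plus_plus_mul_plus := by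
    rintro ⟨x⟩ ⟨y⟩
    exact Quotient.sound (LeftAdequateRel.plus_plus_mul_plus x y)
  plus_mul_comm := by
    rintro ⟨x⟩ ⟨y⟩
    exact Quotient.sound (LeftAdequateRel.plus_mul_comm x y)
  plus_mul := by
    rintro ⟨x⟩ ⟨y⟩
    exact Quotient.sound (LeftAdequateRel.plus_mul x y)
  eq_plus_of_mul_self := by
    rintro ⟨x⟩ h
    exact Quotient.sound (LeftAdequateRel.eq_plus_of_mul_self x (Quotient.exact h))
  mul_plus_eq_of_mul_eq := by
    rintro ⟨x⟩ ⟨y⟩ ⟨z⟩ h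
    exact Quotient.sound (LeftAdequateRel.mul_plus_eq_of_mul_eq x y z (Quotient.exact h))

/-- The free generators. -/
def of {X : Type*} (x : X) : FLAd X :=
  Quotient.mk (LeftAdequateRel.setoid X) (FreeUnaryMonoid.of x)

theorem lift_eq {X M : Type*} [UnaryMonoid M] [IsLeftAdequate M] (f : X → M)
    {s t : FreeUnaryMonoid X} (h : LeftAdequateRel s t) :
    FreeUnaryMonoid.lift f s = FreeUnaryMonoid.lift f t := by
  have hm : ∀ a b, FreeUnaryMonoid.lift f (a * b) =
      FreeUnaryMonoid.lift f a * FreeUnaryMonoid.lift f b := (FreeUnaryMonoid.lift f).map_mul'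
  have hp : ∀ a, FreeUnaryMonoid.lift f (UnaryMonoid.plus a) =
      UnaryMonoid.plus (FreeUnaryMonoid.lift f a) := (FreeUnaryMonoid.lift f).map_plus'
  induction h with
  | refl => rfl
  | symm _ ih => exact ih.symm
  | trans _ _ ih ih' => exact ih.trans ih'
  | mul _ _ ih ih' => rw [hm, hm, ih, ih']
  | plus _ ih => rw [hp, hp, ih]
  | plus_mul_self => rw [hm, hp, IsLeftAdequate.plus_mul_self]
  | plus_plus_mul_plus => simp only [hm, hp, IsLeftAdequate.plus_plus_mul_plus]
  | plus_mul_comm => simp only [hm, hp]; exact IsLeftAdequate.plus_mul_comm _ _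
  | plus_mul => simp only [hm, hp]; exact IsLeftAdequate.plus_mul _ _
  | eq_plus_of_mul_self _ _ ih =>
    rw [hm] at ih
    rw [hp]
    exact IsLeftAdequate.eq_plus_of_mul_self _ ih
  | mul_plus_eq_of_mul_eq _ _ _ _ ih =>
    rw [hm, hm] at ih
    rw [hm, hm, hp]
    exact IsLeftAdequate.mul_plus_eq_of_mul_eq _ _ _ ih

/-- The universal property of `FLAd(X)`: it is the left adequate monoid freely generated by `X`. -/
theorem existsUnique_lift {X M : Type*} [UnaryMonoid M] [IsLeftAdequate M] (f : X → M) :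
    ∃! φ : UnaryMonoidHom (FLAd X) M, ∀ x, φ (of x) = f x := by
  refine ⟨⟨⟨⟨Quotient.lift (FreeUnaryMonoid.lift f) fun _ _ h => lift_eq f h, rfl⟩, ?_⟩, ?_⟩,
    fun x => rfl, fun φ hφ => DFunLike.ext _ _ fun s => ?_⟩
  · rintro ⟨x⟩ ⟨y⟩
    exact (FreeUnaryMonoid.lift f).map_mul' x y
  · rintro ⟨x⟩
    exact (FreeUnaryMonoid.lift f).map_plus' x
  · obtain ⟨s⟩ := s
    change φ (Quotient.mk _ s) = FreeUnaryMonoid.lift f s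
    induction s using FreeUnaryMonoid.induction with
    | var x => exact hφ x
    | one => exact φ.map_one'.trans (FreeUnaryMonoid.lift f).map_one'.symm
    | mul s t hs ht =>
      exact (φ.map_mul' (Quotient.mk _ s) (Quotient.mk _ t)).trans
        ((congrArg₂ (· * ·) hs ht).trans ((FreeUnaryMonoid.lift f).map_mul' s t).symm)
    | plus s hs =>
      exact (φ.map_plus' (Quotient.mk _ s)).trans
        ((congrArg UnaryMonoid.plus hs).trans ((FreeUnaryMonoid.lift f).map_plus' s).symm)

end FLAd

/-! ## Identities -/

/-- The unary monoid `M` satisfies the (enriched) identity `u ≈ v` over `S`. -/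
def SatisfiesIdentity (M : Type*) [UnaryMonoid M] {S : Type*} (u v : FreeUnaryMonoid S) : Prop :=
  ∀ φ : UnaryMonoidHom (FreeUnaryMonoid S) M, φ u = φ v

/-- The extended alphabet `S ∪ {w⁺ : w a word over S}`. -/
inductive ExtLetter (S : Type*) where
  /-- a letter of `S` -/
  | letter : S → ExtLetter S
  /-- the symbol `w⁺` for a word `w` over `S` (`w` may be empty) -/
  | idem : FreeMonoid S → ExtLetter S

instance {S : Type*} [DecidableEq S] : DecidableEq (ExtLetter S)
  | .letter x, .letter y => decidable_of_iff (x = y) (by simp)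
  | .idem w, .idem k =>
    decidable_of_iff (w.toList = k.toList) (by simp [EmbeddingLike.apply_eq_iff_eq])
  | .letter _, .idem _ => isFalse (by simp)
  | .idem _, .letter _ => isFalse (by simp)

/-- Non-nested words over `S`: elements of the free monoid over the extended alphabet. -/
abbrev NonNestedWord (S : Type*) : Type _ := FreeMonoid (ExtLetter S)

namespace NonNestedWord

/-- The element of the free unary monoid that a non-nested word denotes. -/
def toFreeUnary {S : Type*} : NonNestedWord S →* FreeUnaryMonoid S :=
  FreeMonoid.lift fun
    | .letter x => FreeUnaryMonoid.of x
    | .idem w => UnaryMonoid.plus (FreeMonoid.lift FreeUnaryMonoid.of w)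

end NonNestedWord

/-! ## Combinatorics of words -/

namespace FreeMonoid

/-- `u.occ x` is `|u|_x`, the number of occurrences of `x` in `u`. -/
def occ {α : Type*} [DecidableEq α] (u : FreeMonoid α) (x : α) : ℕ := u.toList.count x

/-- `supp(u)`, the set of letters that occur in `u`. -/
def supp {α : Type*} (u : FreeMonoid α) : Set α := {x | x ∈ u.toList}

/-- `u.mp x` is `mp_u(x)`, the longest prefix of `u` that ends in `x`
(the empty word if `x` does not occur in `u`). -/
def mp {α : Type*} [DecidableEq α] (u : FreeMonoid α) (x : α) : FreeMonoid α :=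
  ofList (u.toList.rdropWhile fun a => decide (a ≠ x))

/-- The part of `u` to the right of the last occurrence of `x`; thus `u = u.mp x * u.afterLast x`. -/
def afterLast {α : Type*} [DecidableEq α] (u : FreeMonoid α) (x : α) : FreeMonoid α :=
  ofList (u.toList.rtakeWhile fun a => decide (a ≠ x))

end FreeMonoid

/-- Whether a symbol of the extended alphabet is some `w⁺`. -/
def ExtLetter.isIdem {S : Type*} : ExtLetter S → Bool
  | .letter _ => false
  | .idem _ => true

namespace NonNestedWord

/-- The inclusion of the words over `S` into the non-nested words. -/
def ofWord {S : Type*} : FreeMonoid S →* NonNestedWord S := FreeMonoid.map ExtLetter.letter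

/-- `u.erase` is the word over `S` obtained by removing all the symbols `w⁺` from `u`. -/
def erase {S : Type*} : NonNestedWord S →* FreeMonoid S :=
  FreeMonoid.lift fun
    | .letter x => FreeMonoid.of x
    | .idem _ => 1

/-- `suff u x` is `suff_u(x)`, for `x` in the support of `u`.
For a letter `x` of `S`, it is the shortest suffix of `u` containing `x`.
For `w⁺`, it is the longest suffix of `u` in which no letter of `S` is to the left of any copy of
`w⁺`: the suffix following the last `w⁺`, preceded by the maximal block of symbols `k⁺` that ends
in the last `w⁺`. -/
def suff {S : Type*} [DecidableEq S] (u : NonNestedWord S) : ExtLetter S → NonNestedWord S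
  | .letter x => FreeMonoid.of (.letter x) * u.afterLast (.letter x)
  | .idem w =>
    FreeMonoid.ofList ((u.mp (.idem w)).toList.rtakeWhile ExtLetter.isIdem) * u.afterLast (.idem w)

/-- The set `P^u_{w,x}`. -/
def setP {S : Type*} [DecidableEq S] (u : NonNestedWord S) (w : FreeMonoid S) (x : S) :
    Set (NonNestedWord S) :=
  {q | ∃ k : FreeMonoid S, ExtLetter.idem k ∈ (suff u (.idem w)).supp ∧ x ∈ k.supp ∧
    q = ofWord (erase ((suff u (.idem w)).mp (.idem k))) * FreeMonoid.of (.idem k)}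

/-- The set `Q^u_{w,x}`: one more element if the letter `x` occurs in `suff_u(w⁺)`. -/
def setQ {S : Type*} [DecidableEq S] (u : NonNestedWord S) (w : FreeMonoid S) (x : S) :
    Set (NonNestedWord S) :=
  setP u w x ∪ {q | ExtLetter.letter x ∈ (suff u (.idem w)).supp ∧
    q = ofWord (erase (suff u (.idem w))) * FreeMonoid.of (.idem 1)}

/-- The set `R^u_{w,x}`. -/
def setR {S : Type*} [DecidableEq S] (u : NonNestedWord S) (w : FreeMonoid S) (x : S) :
    Set (NonNestedWord S) :=
  setQ u w x \ {q | ∃ k : FreeMonoid S, q = FreeMonoid.of (.idem k) ∧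
    ∀ y : S, (w.mp x).occ y = (k.mp x).occ y}

end NonNestedWord

/-! ## A concrete model of the monogenic free left adequate monoid -/

/-! Elements of the monogenic free left adequate monoid are pruned trees: a trunk with branches,
each recorded by the vertex where it leaves and the height it attains. `Profile` models this.
Sending the generator to an edge gives `FLAd.profile`, which is injective because every element has
a normal form (`exists_eq_trunk`) that can be read off from its profile (`trunk_eq_of_profile_eq`).
Identities may therefore be tested on profiles.

Under a substitution with trunk lengths `ψ`, each occurrence of a letter `x`, and each `w⁺` with `x`
in `w`, plants a copy of the tree of `x`. The end of the trunk of that copy is governed by a pair of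
multisets: the content to the right of the occurrence, and the content of `mp_w(x)` (or `0` for a
letter). Measured from the end of the whole trunk, the copy is attached at `-ψ(c.1)` and its trunk
ends at height `-ψ(c.1) + ψ(c.2)`; `Dom` says that one pair is at least as good in both coordinates.
A very long branch on `x` alone makes exactly the contributions of `x` visible, so an identity holds
iff the letter contents agree and, for all `ψ` and `x`, the contributions of the two sides dominate
each other (`satisfiesIdentity_iff_dominated`).

The rest is planar combinatorics. Every `ψ` can be perturbed to positive, generic weights
(`exists_generic`). For these, every contribution is dominated by an undominated one, a corner
(`exists_corner`), and mutually dominating sets have the same corners (`Corner.transfer`). The set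
`R` lists exactly the rivals of the contribution of `x` to the last `w⁺`
(`exists_contrib_of_mem_setR`, `exists_mem_setR_of_dom`). So (iii)(a) says that this contribution is
never needed, while (iii)(b) supplies it on the other side; (ii) plays the same role for the last
letter `x`. No mirror image of (ii) is required, by `Corner.mem_of_letterCondition_symm`.

Nested terms reduce to non-nested ones because `(yu)⁺` is the product of the `(yk)⁺` when `u⁺` is a
nonempty product of the `k⁺`. -/

/-- A trunk of length `len` with branches: `reach i h` says that some branch that leaves the trunk
at a vertex `≥ i` reaches the height `h`. -/
@[ext]
structure Profile where
  /-- the length of the trunk -/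
  len : ℕ
  /-- the heights reached by the branches -/
  reach : ℕ → ℕ → Prop
  le_len : ∀ {i h}, reach i h → i ≤ len
  low : ∀ {i h}, i ≤ len → h ≤ len → reach i h
  down : ∀ {i h i' h'}, reach i h → i' ≤ i → h' ≤ h → reach i' h'

namespace Profile

instance : UnaryMonoid Profile where
  one := ⟨0, fun i h => i = 0 ∧ h = 0, by omega, by omega, by omega⟩
  -- The second tree is glued to the end of the first trunk. Truncated subtraction is right here:
  -- from a vertex `i ≤ s.len` all branches of `t` are available, and heights up to `s.len` are
  -- reached anyway.
  mul s t := ⟨s.len + t.len, fun i h => s.reach i h ∨ t.reach (i - s.len) (h - s.len), by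
      rintro i h (hs | ht)
      · have := s.le_len hs; omega
      · have := t.le_len ht; omega, by
      intro i h hi hh
      exact Or.inr (t.low (by omega) (by omega)), by
      rintro i h i' h' (hs | ht) hi hh
      · exact Or.inl (s.down hs hi hh)
      · exact Or.inr (t.down ht (by omega) (by omega))⟩
  plus s := ⟨0, fun i h => i = 0 ∧ s.reach 0 h, by omega, by
      intro i h hi hh
      exact ⟨by omega, s.low (by omega) (by omega)⟩, by
      rintro i h i' h' ⟨h1, h2⟩ hi hh
      exact ⟨by omega, s.down h2 le_rfl hh⟩⟩
  mul_assoc s t r := by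
    apply Profile.ext
    · exact Nat.add_assoc _ _ _
    · funext i h
      change ((_ ∨ _) ∨ r.reach (i - (s.len + t.len)) (h - (s.len + t.len))) = (_ ∨ (_ ∨ _))
      simp only [Nat.sub_sub, or_assoc]
  one_mul s := by
    apply Profile.ext
    · exact Nat.zero_add _
    · funext i h
      change ((i = 0 ∧ h = 0) ∨ s.reach i h) = s.reach i h
      apply propext
      constructor
      · rintro (⟨rfl, rfl⟩ | h)
        · exact s.low (by omega) (by omega)
        · exact h
      · exact Or.inr
  mul_one s := by
    apply Profile.ext
    · exact Nat.add_zero _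
    · funext i h
      change (s.reach i h ∨ (i - s.len = 0 ∧ h - s.len = 0)) = s.reach i h
      apply propext
      constructor
      · rintro (h | ⟨h1, h2⟩)
        · exact h
        · exact s.low (by omega) (by omega)
      · exact Or.inl

theorem len_mul (s t : Profile) : (s * t).len = s.len + t.len := rfl

theorem len_plus (s : Profile) : (UnaryMonoid.plus s).len = 0 := rfl

theorem reach_one (i h : ℕ) : (1 : Profile).reach i h ↔ i = 0 ∧ h = 0 := Iff.rfl

theorem reach_mul (s t : Profile) (i h : ℕ) :
    (s * t).reach i h ↔ s.reach i h ∨ t.reach (i - s.len) (h - s.len) := Iff.rfl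

theorem reach_plus (s : Profile) (i h : ℕ) :
    (UnaryMonoid.plus s).reach i h ↔ i = 0 ∧ s.reach 0 h := Iff.rfl

theorem ext_iff' {s t : Profile} :
    s = t ↔ s.len = t.len ∧ ∀ i h, s.reach i h ↔ t.reach i h := by
  constructor
  · rintro rfl
    exact ⟨rfl, fun _ _ => Iff.rfl⟩
  · rintro ⟨h1, h2⟩
    exact Profile.ext h1 (by funext i h; exact propext (h2 i h))

instance : IsLeftAdequate Profile where
  plus_mul_self s := by
    rw [ext_iff']
    refine ⟨by simp [len_mul, len_plus], fun i h => ?_⟩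
    simp only [reach_mul, reach_plus, len_plus, Nat.sub_zero]
    constructor
    · rintro (⟨rfl, h⟩ | h) <;> exact h
    · exact Or.inr
  plus_plus_mul_plus s t := by
    rw [ext_iff']
    refine ⟨rfl, fun i h => ?_⟩
    simp only [reach_mul, reach_plus, len_plus, Nat.sub_zero]
    tauto
  plus_mul_comm s t := by
    rw [ext_iff']
    refine ⟨rfl, fun i h => ?_⟩
    simp only [reach_mul, reach_plus, len_plus, Nat.sub_zero]
    tauto
  plus_mul s t := by
    rw [ext_iff']
    refine ⟨rfl, fun i h => ?_⟩
    simp only [reach_mul, reach_plus, Nat.zero_sub, true_and]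
  eq_plus_of_mul_self s hs := by
    have h0 : s.len = 0 := by
      have := congrArg Profile.len hs
      rw [len_mul] at this
      omega
    rw [ext_iff']
    refine ⟨h0, fun i h => ?_⟩
    rw [reach_plus]
    constructor
    · intro hr
      have := s.le_len hr
      obtain rfl : i = 0 := by omega
      exact ⟨rfl, hr⟩
    · rintro ⟨rfl, hr⟩
      exact hr
  mul_plus_eq_of_mul_eq s t r hst := by
    rw [ext_iff'] at hst ⊢
    obtain ⟨h1, h2⟩ := hst
    rw [len_mul, len_mul] at h1
    have hl : s.len = t.len := by omega
    refine ⟨by rw [len_mul, len_mul, hl], fun i h => ?_⟩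
    have h3 := h2 i h
    simp only [reach_mul, reach_plus, hl] at h3 ⊢
    -- Up to the end of the common trunk the truncated index is `0`, where `r` and `r⁺` agree;
    -- beyond it neither `s` nor `t` reaches anything.
    by_cases hi : i ≤ t.len
    · have : i - t.len = 0 := by omega
      simpa [this] using h3
    · have hi1 : ¬ s.reach i h := fun hr => by have := s.le_len hr; omega
      have hi2 : ¬ t.reach i h := fun hr => by have := t.le_len hr; omega
      simp [hi1, hi2]

/-- The edge. -/
def edge : Profile := ⟨1, fun i h => i ≤ 1 ∧ h ≤ 1, by omega, by omega, by omega⟩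

theorem edge_mul_reach (s : Profile) (i h : ℕ) :
    (edge * s).reach i h ↔ s.reach (i - 1) (h - 1) := by
  rw [reach_mul]
  change (i ≤ 1 ∧ h ≤ 1) ∨ _ ↔ _
  constructor
  · rintro (⟨h1, h2⟩ | h)
    · exact s.low (by omega) (by omega)
    · exact h
  · exact Or.inr

theorem edge_mul_len (s : Profile) : (edge * s).len = 1 + s.len := rfl

theorem edge_pow (n : ℕ) : (edge ^ n).len = n ∧ ∀ i h, (edge ^ n).reach i h ↔ i ≤ n ∧ h ≤ n := by
  induction n with
  | zero => exact ⟨rfl, fun i h => by rw [pow_zero, reach_one]; omega⟩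
  | succ n ih =>
    rw [pow_succ']
    refine ⟨by rw [edge_mul_len, ih.1]; omega, fun i h => ?_⟩
    rw [edge_mul_reach, ih.2]
    omega

end Profile

/-! ## Normal forms in the monogenic free left adequate monoid -/

namespace UnaryMonoidHom

variable {M N : Type*} [UnaryMonoid M] [UnaryMonoid N] (φ : UnaryMonoidHom M N)

theorem map_one : φ 1 = 1 := φ.map_one'

theorem map_mul (s t : M) : φ (s * t) = φ s * φ t := φ.map_mul' s t

theorem map_plus (s : M) : φ (UnaryMonoid.plus s) = UnaryMonoid.plus (φ s) := φ.map_plus' s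

theorem map_pow (s : M) (n : ℕ) : φ (s ^ n) = φ s ^ n := by
  induction n with
  | zero => rw [pow_zero, pow_zero, φ.map_one]
  | succ n ih => rw [pow_succ, pow_succ, φ.map_mul, ih]

end UnaryMonoidHom

namespace IsLeftAdequate

open UnaryMonoid

variable {M : Type*} [UnaryMonoid M] [IsLeftAdequate M]

theorem plus_one : plus (1 : M) = 1 := by
  have := plus_mul_self (1 : M)
  rwa [mul_one] at this

theorem plus_plus (x : M) : plus (plus x) = plus x := by
  have := plus_plus_mul_plus x 1
  rwa [plus_one, mul_one] at this

theorem plus_plus_mul (x y : M) : plus (plus x * y) = plus x * plus y := by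
  rw [plus_mul, plus_plus_mul_plus]

theorem plus_mul_plus_mul (x y : M) : plus x * plus (x * y) = plus (x * y) := by
  rw [← plus_plus_mul, ← mul_assoc, plus_mul_self]

theorem plus_mul_mul_plus (x y : M) : plus (x * y) * (x * plus y) = x * plus y := by
  rw [plus_mul, plus_mul_self]

theorem plus_pow_mul_plus_pow (a : M) (c d : ℕ) :
    plus (a ^ c) * plus (a ^ d) = plus (a ^ max c d) := by
  rcases le_total c d with h | h
  · obtain ⟨e, rfl⟩ := Nat.exists_eq_add_of_le h
    rw [max_eq_right h, pow_add, plus_mul_plus_mul]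
  · obtain ⟨e, rfl⟩ := Nat.exists_eq_add_of_le h
    rw [max_eq_left h, plus_mul_comm, pow_add, plus_mul_plus_mul]

/-- The element `(a ^ c)⁺ a (a ^ c₁)⁺ a ⋯ a (a ^ cₙ)⁺`. -/
def trunk (a : M) : ℕ → List ℕ → M
  | c, [] => plus (a ^ c)
  | c, d :: l => plus (a ^ c) * (a * trunk a d l)

theorem plus_pow_mul_trunk (a : M) (c d : ℕ) (l : List ℕ) :
    plus (a ^ c) * trunk a d l = trunk a (max c d) l := by
  cases l with
  | nil => exact plus_pow_mul_plus_pow a c d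
  | cons e l => rw [trunk, ← mul_assoc, plus_pow_mul_plus_pow, trunk]

/-- A branch of length `d` at the next vertex has length `d + 1` when seen from the current one, so
it absorbs a branch of that length. -/
theorem plus_pow_mul_mul_trunk (a : M) (d : ℕ) (l : List ℕ) :
    plus (a ^ (d + 1)) * (a * trunk a d l) = a * trunk a d l := by
  have h : trunk a d l = plus (a ^ d) * trunk a d l := by
    rw [plus_pow_mul_trunk, max_self]
  rw [h, ← mul_assoc a, ← mul_assoc, pow_succ', plus_mul_mul_plus]

/-- The exponents decrease strictly along the trunk. -/
abbrev Descending (c : ℕ) (l : List ℕ) : Prop := List.IsChain (fun c d => d + 1 ≤ c) (c :: l)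

/-- Each exponent may be raised to one more than its successor without changing the element. Working
from the right end, this repairs any sequence, so nothing is assumed about the exponents of the left
factor. -/
theorem exists_trunk_mul (a : M) (c : ℕ) (l : List ℕ) (c' : ℕ) (l' : List ℕ)
    (h' : Descending c' l') :
    ∃ d r, Descending d r ∧ trunk a c l * trunk a c' l' = trunk a d r := by
  induction l generalizing c with
  | nil =>
    refine ⟨max c c', l', ?_, plus_pow_mul_trunk a c c' l'⟩
    cases l' with
    | nil => exact List.isChain_singleton _
    | cons e l' =>
      rw [Descending, List.isChain_cons_cons] at h' ⊢
      exact ⟨by omega, h'.2⟩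
  | cons e l ih =>
    obtain ⟨d, r, hd, hr⟩ := ih e
    refine ⟨max c (d + 1), d :: r, List.isChain_cons_cons.2 ⟨by omega, hd⟩, ?_⟩
    rw [trunk, mul_assoc, mul_assoc, hr, trunk, ← plus_pow_mul_plus_pow, mul_assoc,
      plus_pow_mul_mul_trunk]

/-- With descending exponents the branch at the root is the tallest, and it absorbs the rest of the
tree. -/
theorem plus_trunk (a : M) (c : ℕ) (l : List ℕ) (h : Descending c l) :
    plus (trunk a c l) = plus (a ^ c) := by
  induction l generalizing c with
  | nil => exact plus_plus _
  | cons d l ih =>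
    obtain ⟨h1, h2⟩ := List.isChain_cons_cons.1 h
    rw [trunk, plus_plus_mul, plus_mul, ih d h2, ← plus_mul, ← pow_succ', plus_pow_mul_plus_pow,
      max_eq_left h1]

end IsLeftAdequate

namespace FLAd

open UnaryMonoid IsLeftAdequate

theorem exists_eq_trunk (s : FLAd Unit) :
    ∃ c l, Descending c l ∧ s = trunk (FLAd.of ()) c l := by
  obtain ⟨s⟩ := s
  change ∃ c l, Descending c l ∧ (Quotient.mk _ s : FLAd Unit) = _
  induction s using FreeUnaryMonoid.induction with
  | var x =>
    refine ⟨1, [0], by simp [Descending], ?_⟩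
    rw [trunk, trunk, pow_zero, plus_one, mul_one, pow_one, plus_mul_self]
    rfl
  | one =>
    refine ⟨0, [], List.isChain_singleton _, ?_⟩
    rw [trunk, pow_zero, plus_one]
    rfl
  | mul s t hs ht =>
    obtain ⟨c, l, _, hs⟩ := hs
    obtain ⟨c', l', h', ht⟩ := ht
    obtain ⟨d, r, hd, hr⟩ := exists_trunk_mul (FLAd.of ()) c l c' l' h'
    refine ⟨d, r, hd, ?_⟩
    rw [← hr, ← hs, ← ht]
    rfl
  | plus s hs =>
    obtain ⟨c, l, h, hs⟩ := hs
    refine ⟨c, [], List.isChain_singleton _, ?_⟩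
    rw [trunk, ← plus_trunk _ c l h, ← hs]
    rfl

/-- The profile of an element of the monogenic free left adequate monoid. -/
noncomputable def profile : UnaryMonoidHom (FLAd Unit) Profile :=
  (existsUnique_lift fun _ : Unit => Profile.edge).choose

theorem profile_of : profile (of ()) = Profile.edge :=
  (existsUnique_lift fun _ : Unit => Profile.edge).choose_spec.1 ()

theorem reach_profile_trunk (c : ℕ) (l : List ℕ) (h : Descending c l) (k : ℕ) :
    (profile (trunk (FLAd.of ()) c l)).reach 0 k ↔ k ≤ c := by
  have h1 := congrArg (fun s => (profile s).reach 0 k) (plus_trunk (FLAd.of ()) c l h)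
  simp only [UnaryMonoidHom.map_plus, UnaryMonoidHom.map_pow, profile_of, Profile.reach_plus,
    true_and, (Profile.edge_pow c).2, zero_le] at h1
  rw [h1]

theorem profile_trunk_cons_len (c d : ℕ) (l : List ℕ) :
    (profile (trunk (FLAd.of ()) c (d :: l))).len =
      1 + (profile (trunk (FLAd.of ()) d l)).len := by
  rw [trunk, UnaryMonoidHom.map_mul, UnaryMonoidHom.map_plus, UnaryMonoidHom.map_mul, profile_of,
    Profile.len_mul, Profile.len_plus, Profile.edge_mul_len, Nat.zero_add]

theorem profile_trunk_cons_reach (c d : ℕ) (l : List ℕ) (i k : ℕ) :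
    (profile (trunk (FLAd.of ()) c (d :: l))).reach (i + 1) (k + 1) ↔
      (profile (trunk (FLAd.of ()) d l)).reach i k := by
  rw [trunk, UnaryMonoidHom.map_mul, UnaryMonoidHom.map_plus, UnaryMonoidHom.map_mul, profile_of,
    Profile.reach_mul, Profile.len_plus, Profile.edge_mul_reach, Profile.reach_plus]
  simp

/-- The first exponent is the greatest height reached from the root. Removing the root and its edge
shifts the profile by one in both coordinates, so the remaining exponents follow by induction. -/
theorem trunk_eq_of_profile_eq (c : ℕ) (l : List ℕ) (h : Descending c l) (c' : ℕ) (l' : List ℕ)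
    (h' : Descending c' l')
    (he : profile (trunk (FLAd.of ()) c l) = profile (trunk (FLAd.of ()) c' l')) :
    c = c' ∧ l = l' := by
  induction l generalizing c c' l' with
  | nil =>
    have h0 : (profile (trunk (FLAd.of ()) c [])).len = 0 := by
      rw [trunk, UnaryMonoidHom.map_plus, Profile.len_plus]
    cases l' with
    | nil =>
      refine ⟨?_, rfl⟩
      have h1 := reach_profile_trunk c [] h
      rw [he] at h1
      have h2 := reach_profile_trunk c' [] h'
      exact le_antisymm ((h2 c).1 ((h1 c).2 le_rfl)) ((h1 c').1 ((h2 c').2 le_rfl))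
    | cons d' l' =>
      rw [he, profile_trunk_cons_len] at h0
      omega
  | cons d l ih =>
    cases l' with
    | nil =>
      have h0 : (profile (trunk (FLAd.of ()) c' [])).len = 0 := by
        rw [trunk, UnaryMonoidHom.map_plus, Profile.len_plus]
      rw [← he, profile_trunk_cons_len] at h0
      omega
    | cons d' l' =>
      have h1 := reach_profile_trunk c _ h
      rw [he] at h1
      have h2 := reach_profile_trunk c' _ h'
      have hc : c = c' :=
        le_antisymm ((h2 c).1 ((h1 c).2 le_rfl)) ((h1 c').1 ((h2 c').2 le_rfl))
      have hl := congrArg Profile.len he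
      rw [profile_trunk_cons_len, profile_trunk_cons_len] at hl
      obtain ⟨rfl, rfl⟩ := ih d (List.isChain_cons_cons.1 h).2 d' l' (List.isChain_cons_cons.1 h').2
        (Profile.ext_iff'.2 ⟨by omega, fun i k => by
          rw [← profile_trunk_cons_reach c, he, profile_trunk_cons_reach]⟩)
      exact ⟨hc, rfl⟩

theorem profile_injective : Function.Injective profile := by
  intro s t hst
  obtain ⟨c, l, h, rfl⟩ := exists_eq_trunk s
  obtain ⟨c', l', h', rfl⟩ := exists_eq_trunk t
  obtain ⟨rfl, rfl⟩ := trunk_eq_of_profile_eq c l h c' l' h' hst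
  rfl

/-- Every trunk with a single branch, at its end, is the profile of some element. -/
theorem exists_profile (n d : ℕ) :
    ∃ s : FLAd Unit, (profile s).len = n ∧
      ∀ i h, (profile s).reach i h ↔ i ≤ n ∧ h ≤ n + d := by
  refine ⟨of () ^ n * plus (of () ^ d), ?_⟩
  rw [UnaryMonoidHom.map_mul, UnaryMonoidHom.map_plus, UnaryMonoidHom.map_pow,
    UnaryMonoidHom.map_pow, profile_of]
  refine ⟨by rw [Profile.len_mul, (Profile.edge_pow n).1, Profile.len_plus, Nat.add_zero],
    fun i h => ?_⟩
  rw [Profile.reach_mul, Profile.reach_plus, (Profile.edge_pow n).1, (Profile.edge_pow n).2,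
    (Profile.edge_pow d).2]
  omega

end FLAd

/-! ## Last occurrences -/

namespace List

variable {α : Type*}

theorem exists_eq_append_cons_last {l : List α} {x : α} (h : x ∈ l) :
    ∃ p s, l = p ++ x :: s ∧ x ∉ s := by
  obtain ⟨p, s, h1, h2⟩ := List.eq_append_cons_of_mem (List.mem_reverse.2 h)
  refine ⟨s.reverse, p.reverse, ?_, by simpa using h2⟩
  rw [← List.reverse_reverse l, h1]
  simp

variable [DecidableEq α]

theorem rdropWhile_ne_append_cons (p s : List α) {x : α} (h : x ∉ s) :
    (p ++ x :: s).rdropWhile (fun a => decide (a ≠ x)) = p ++ [x] := by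
  induction s using List.reverseRecOn with
  | nil => exact List.rdropWhile_concat_neg _ _ _ (by simp)
  | append_singleton s y ih =>
    rw [List.mem_append, List.mem_singleton, not_or] at h
    rw [← List.cons_append, ← List.append_assoc,
      List.rdropWhile_concat_pos _ _ _ (by simp [Ne.symm h.2])]
    exact ih h.1

theorem rtakeWhile_ne_append_cons (p s : List α) {x : α} (h : x ∉ s) :
    (p ++ x :: s).rtakeWhile (fun a => decide (a ≠ x)) = s := by
  induction s using List.reverseRecOn with
  | nil => exact List.rtakeWhile_concat_neg _ _ _ (by simp)
  | append_singleton s y ih =>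
    rw [List.mem_append, List.mem_singleton, not_or] at h
    rw [← List.cons_append, ← List.append_assoc,
      List.rtakeWhile_concat_pos _ _ _ (by simp [Ne.symm h.2])]
    rw [ih h.1]

end List

namespace FreeMonoid

variable {α : Type*} [DecidableEq α]

/-- The content of the longest prefix of `w` that ends in `x`. -/
def upTo (w : FreeMonoid α) (x : α) : Multiset α := ((w.mp x).toList : Multiset α)

theorem toList_mp {w : FreeMonoid α} {x : α} {p s : List α} (h : w.toList = p ++ x :: s)
    (hs : x ∉ s) : (w.mp x).toList = p ++ [x] := by
  rw [mp, h, List.rdropWhile_ne_append_cons p s hs]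
  rfl

theorem toList_afterLast {w : FreeMonoid α} {x : α} {p s : List α} (h : w.toList = p ++ x :: s)
    (hs : x ∉ s) : (w.afterLast x).toList = s := by
  rw [afterLast, h, List.rtakeWhile_ne_append_cons p s hs]
  rfl

theorem upTo_eq {w : FreeMonoid α} {x : α} {p s : List α} (h : w.toList = p ++ x :: s)
    (hs : x ∉ s) : w.upTo x = x ::ₘ (p : Multiset α) := by
  rw [upTo, toList_mp h hs, ← Multiset.coe_add, Multiset.coe_singleton, add_comm,
    Multiset.singleton_add]

theorem mem_upTo {w : FreeMonoid α} {x : α} (h : x ∈ w.toList) : x ∈ w.upTo x := by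
  obtain ⟨p, s, h1, h2⟩ := List.exists_eq_append_cons_last h
  rw [upTo_eq h1 h2]
  exact Multiset.mem_cons_self _ _

theorem upTo_ne_zero {w : FreeMonoid α} {x : α} (h : x ∈ w.toList) : w.upTo x ≠ 0 := fun h0 => by
  simpa [h0] using mem_upTo h

theorem upTo_le (w : FreeMonoid α) (x : α) : w.upTo x ≤ (w.toList : Multiset α) := by
  rw [upTo, Multiset.coe_le]
  exact (List.rdropWhile_prefix _ _).sublist.subperm

theorem upTo_of_mul_of_mem {w : FreeMonoid α} {x : α} (p : FreeMonoid α) (h : x ∈ w.toList) :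
    (p * w).upTo x = (p.toList : Multiset α) + w.upTo x := by
  obtain ⟨q, s, h1, h2⟩ := List.exists_eq_append_cons_last h
  rw [upTo_eq h1 h2, upTo_eq (p := p.toList ++ q) (s := s) _ h2, ← Multiset.coe_add,
    Multiset.add_cons]
  rw [FreeMonoid.toList_mul, h1, List.append_assoc]

theorem upTo_of_mul_of_notMem {w : FreeMonoid α} {x : α} (h : x ∉ w.toList) :
    (FreeMonoid.of x * w).upTo x = {x} := by
  rw [upTo_eq (p := []) (s := w.toList) _ h]
  · rfl
  · rw [FreeMonoid.toList_mul, FreeMonoid.toList_of]; rfl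

theorem occ_mp (w : FreeMonoid α) (x y : α) : (w.mp x).occ y = (w.upTo x).count y := by
  rw [occ, upTo, Multiset.coe_count]

end FreeMonoid

/-! ## Weights -/

/-- The weight of a multiset of letters. -/
def weight {S : Type*} (ψ : S → ℕ) (m : Multiset S) : ℕ := (m.map ψ).sum

section weight

variable {S : Type*} (ψ : S → ℕ)

@[simp] theorem weight_zero : weight ψ 0 = 0 := rfl

@[simp] theorem weight_cons (x : S) (m : Multiset S) :
    weight ψ (x ::ₘ m) = ψ x + weight ψ m := by
  simp [weight]

@[simp] theorem weight_singleton (x : S) : weight ψ {x} = ψ x := by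
  simp [weight]

@[simp] theorem weight_add (m m' : Multiset S) :
    weight ψ (m + m') = weight ψ m + weight ψ m' := by
  simp [weight]

theorem weight_mono {m m' : Multiset S} (h : m ≤ m') : weight ψ m ≤ weight ψ m' := by
  obtain ⟨r, rfl⟩ := Multiset.le_iff_exists_add.1 h
  simp

theorem le_weight_of_mem {x : S} {m : Multiset S} (h : x ∈ m) : ψ x ≤ weight ψ m := by
  obtain ⟨r, rfl⟩ := Multiset.exists_cons_of_mem h
  simp

end weight

/-! ## Contributions -/

namespace NonNestedWord

variable {S : Type*} [DecidableEq S]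

/-- The letters of `S` in a non-nested word, with multiplicities. -/
def letters : List (ExtLetter S) → Multiset S
  | [] => 0
  | .letter y :: u => y ::ₘ letters u
  | .idem _ :: u => letters u

/-- The contributions of the letter `x`: the first component is the content of the word to the
right of an occurrence of `x` or of some `w⁺` with `x` in `w`, the second one is `0` or the content
of the longest prefix of `w` that ends in `x`, respectively. -/
def contrib (x : S) : List (ExtLetter S) → List (Multiset S × Multiset S)
  | [] => []
  | .letter y :: u => if x = y then (letters u, 0) :: contrib x u else contrib x u
  | .idem w :: u => if x ∈ w.toList then (letters u, w.upTo x) :: contrib x u else contrib x u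

theorem mem_contrib_letter {x y : S} {u : List (ExtLetter S)} {c : Multiset S × Multiset S} :
    c ∈ contrib x (.letter y :: u) ↔ (x = y ∧ c = (letters u, 0)) ∨ c ∈ contrib x u := by
  rw [contrib]
  split_ifs with h <;> simp [h]

theorem mem_contrib_idem {x : S} {w : FreeMonoid S} {u : List (ExtLetter S)}
    {c : Multiset S × Multiset S} :
    c ∈ contrib x (.idem w :: u) ↔
      (x ∈ w.toList ∧ c = (letters u, w.upTo x)) ∨ c ∈ contrib x u := by
  rw [contrib]
  split_ifs with h <;> simp [h]

/-- A letter contribution leaves out the letter `x` itself, which accounts for the extra `x` in the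
first case. These bounds keep the truncated subtractions in `Hits` honest. -/
theorem contrib_bounds {x : S} {u : List (ExtLetter S)} {c : Multiset S × Multiset S}
    (h : c ∈ contrib x u) :
    (c.2 = 0 ∧ x ::ₘ c.1 ≤ letters u) ∨ (x ∈ c.2 ∧ c.1 ≤ letters u) := by
  induction u with
  | nil => simp [contrib] at h
  | cons l u ih =>
    cases l with
    | letter y =>
      rw [mem_contrib_letter] at h
      rcases h with ⟨rfl, rfl⟩ | h
      · exact Or.inl ⟨rfl, le_rfl⟩
      · have h1 : letters u ≤ letters (.letter y :: u) := Multiset.le_cons_self _ _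
        exact (ih h).imp (fun h => ⟨h.1, h.2.trans h1⟩) (fun h => ⟨h.1, h.2.trans h1⟩)
    | idem w =>
      rw [mem_contrib_idem] at h
      rcases h with ⟨h, rfl⟩ | h
      · exact Or.inr ⟨FreeMonoid.mem_upTo h, le_rfl⟩
      · exact ih h

/-- The contribution `c` of the letter `x` accounts for the point `(i, h)`. -/
def Hits (f : S → Profile) (n i h : ℕ) (x : S) (c : Multiset S × Multiset S) : Prop :=
  (c.2 = 0 ∧ (f x).reach (i + weight (fun y => (f y).len) c.1 + (f x).len - n)
    (h + weight (fun y => (f y).len) c.1 + (f x).len - n)) ∨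
  (c.2 ≠ 0 ∧ i + weight (fun y => (f y).len) c.1 ≤ n ∧
    (f x).reach 0 (h + weight (fun y => (f y).len) c.1 + (f x).len -
      (n + weight (fun y => (f y).len) c.2)))

/-! ### Evaluation of words and non-nested words in the profile monoid. -/

section eval

variable (φ : UnaryMonoidHom (FreeUnaryMonoid S) Profile)

/-- Only what is visible from the root matters here, and among the copies of `x` the last one starts
highest. It makes the earlier copies redundant. -/
theorem reach_word (w : List S) (h : ℕ) :
    (φ (FreeMonoid.lift FreeUnaryMonoid.of (FreeMonoid.ofList w))).reach 0 h ↔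
      h = 0 ∨ ∃ x ∈ w, (φ (FreeUnaryMonoid.of x)).reach 0
        (h + (φ (FreeUnaryMonoid.of x)).len -
          weight (fun y => (φ (FreeUnaryMonoid.of y)).len) ((FreeMonoid.ofList w).upTo x)) := by
  induction w generalizing h with
  | nil =>
    simp only [List.not_mem_nil, false_and, exists_false, or_false]
    rw [FreeMonoid.ofList_nil, _root_.map_one, φ.map_one, Profile.reach_one]
    simp
  | cons y w ih =>
    rw [FreeMonoid.ofList_cons, _root_.map_mul, FreeMonoid.lift_eval_of, φ.map_mul, Profile.reach_mul,
      Nat.zero_sub, ih]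
    set f : S → Profile := fun y => φ (FreeUnaryMonoid.of y) with hf
    change (f y).reach 0 h ∨ (h - (f y).len = 0 ∨ ∃ x ∈ w, (f x).reach 0
      (h - (f y).len + (f x).len - weight (fun y => (f y).len) ((FreeMonoid.ofList w).upTo x))) ↔
      h = 0 ∨ ∃ x ∈ y :: w, (f x).reach 0
      (h + (f x).len - weight (fun y => (f y).len)
        ((FreeMonoid.of y * FreeMonoid.ofList w).upTo x))
    have hle : ∀ x ∈ w, (f x).len ≤ weight (fun y => (f y).len) ((FreeMonoid.ofList w).upTo x) :=
      fun x hx => le_weight_of_mem (fun y => (f y).len)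
        (FreeMonoid.mem_upTo (w := FreeMonoid.ofList w) hx)
    have hw : ∀ x ∈ w, weight (fun y => (f y).len) ((FreeMonoid.of y * FreeMonoid.ofList w).upTo x)
        = (f y).len + weight (fun y => (f y).len) ((FreeMonoid.ofList w).upTo x) := fun x hx => by
      rw [FreeMonoid.upTo_of_mul_of_mem _ (by exact hx), weight_add, FreeMonoid.toList_of,
        Multiset.coe_singleton, weight_singleton]
    have hy : (f y).reach 0 h → (f y).reach 0 (h + (f y).len - weight (fun y => (f y).len)
        ((FreeMonoid.of y * FreeMonoid.ofList w).upTo y)) := fun hr => by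
      have : (f y).len ≤ weight (fun y => (f y).len)
        ((FreeMonoid.of y * FreeMonoid.ofList w).upTo y) :=
        le_weight_of_mem (fun y => (f y).len) (FreeMonoid.mem_upTo
          (by rw [FreeMonoid.toList_mul, FreeMonoid.toList_of]; simp))
      exact (f y).down hr le_rfl (by omega)
    constructor
    · rintro (hr | hr | ⟨x, hx, hr⟩)
      · exact Or.inr ⟨y, List.mem_cons_self, hy hr⟩
      · exact Or.inr ⟨y, List.mem_cons_self, hy ((f y).low (by omega) (by omega))⟩
      · refine Or.inr ⟨x, List.mem_cons_of_mem _ hx, (f x).down hr le_rfl ?_⟩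
        have := hle x hx
        rw [hw x hx]
        omega
    · rintro (rfl | ⟨x, hx, hr⟩)
      · exact Or.inl ((f y).low (by omega) (by omega))
      · by_cases hxw : x ∈ w
        · refine Or.inr (Or.inr ⟨x, hxw, (f x).down hr le_rfl ?_⟩)
          have := hle x hxw
          rw [hw x hxw]
          omega
        · obtain rfl : x = y := by simpa [hxw] using hx
          rw [FreeMonoid.upTo_of_mul_of_notMem (by exact hxw), weight_singleton,
            Nat.add_sub_cancel] at hr
          exact Or.inl hr

omit [DecidableEq S] in
theorem len_toFreeUnary (u : List (ExtLetter S)) :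
    (φ (toFreeUnary (FreeMonoid.ofList u))).len =
      weight (fun y => (φ (FreeUnaryMonoid.of y)).len) (letters u) := by
  induction u with
  | nil => exact congrArg Profile.len φ.map_one
  | cons l u ih =>
    rw [FreeMonoid.ofList_cons, _root_.map_mul, φ.map_mul, Profile.len_mul, ih]
    cases l with
    | letter y => rw [letters, weight_cons]; rfl
    | idem w =>
      rw [letters, toFreeUnary, FreeMonoid.lift_eval_of, φ.map_plus, Profile.len_plus, Nat.zero_add]

/-- With `n` the total length, a letter `x` starts its copy at `n - weight c.1 - len x`, keeping its
vertices on the trunk. A copy inside `w⁺` hangs from the single vertex `n - weight c.1`, so it is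
only seen from its root, raised by the part of `w` before the last `x`. -/
theorem reach_toFreeUnary (u : List (ExtLetter S)) (i h : ℕ) :
    (φ (toFreeUnary (FreeMonoid.ofList u))).reach i h ↔
      (i ≤ weight (fun y => (φ (FreeUnaryMonoid.of y)).len) (letters u) ∧
        h ≤ weight (fun y => (φ (FreeUnaryMonoid.of y)).len) (letters u)) ∨
      ∃ x, ∃ c ∈ contrib x u, Hits (fun y => φ (FreeUnaryMonoid.of y))
        (weight (fun y => (φ (FreeUnaryMonoid.of y)).len) (letters u)) i h x c := by
  induction u generalizing i h with
  | nil =>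
    rw [FreeMonoid.ofList_nil, _root_.map_one, φ.map_one, Profile.reach_one]
    simp [contrib, letters]
  | cons l u ih =>
    rw [FreeMonoid.ofList_cons, _root_.map_mul, φ.map_mul, Profile.reach_mul, ih]
    set f : S → Profile := fun y => φ (FreeUnaryMonoid.of y) with hf
    set n := weight (fun y => (f y).len) (letters u) with hn
    cases l with
    | letter y =>
      have hl : φ (toFreeUnary (FreeMonoid.of (ExtLetter.letter y))) = f y := rfl
      have hc : weight (fun y => (φ (FreeUnaryMonoid.of y)).len) (letters (.letter y :: u)) =
        (f y).len + n := by rw [letters, weight_cons]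
      rw [hl, hc]
      -- A new letter in front moves the old contributions up by its length. Because they all lie in
      -- the old trunk, by `contrib_bounds`, this cancels against the shift of `i` and `h`.
      have key : ∀ x, ∀ c ∈ contrib x u, (Hits f n (i - (f y).len) (h - (f y).len) x c ↔
          Hits f ((f y).len + n) i h x c) := by
        intro x c hxc
        have hb := contrib_bounds hxc
        unfold Hits
        rcases hb with ⟨h0, hb⟩ | ⟨h0, hb⟩
        · have hb := weight_mono (fun y => (f y).len) hb
          rw [weight_cons, ← hn] at hb
          have e1 : i - (f y).len + weight (fun y => (f y).len) c.1 + (f x).len - n =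
            i + weight (fun y => (f y).len) c.1 + (f x).len - ((f y).len + n) := by omega
          have e2 : h - (f y).len + weight (fun y => (f y).len) c.1 + (f x).len - n =
            h + weight (fun y => (f y).len) c.1 + (f x).len - ((f y).len + n) := by omega
          simp [h0, e1, e2]
        · have hb := weight_mono (fun y => (f y).len) hb
          have hb2 := le_weight_of_mem (fun y => (f y).len) h0
          have h1 : c.2 ≠ 0 := fun h => by simp [h] at h0
          rw [← hn] at hb
          have e1 : i - (f y).len + weight (fun y => (f y).len) c.1 ≤ n ↔
            i + weight (fun y => (f y).len) c.1 ≤ (f y).len + n := by omega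
          have e2 : h - (f y).len + weight (fun y => (f y).len) c.1 + (f x).len -
              (n + weight (fun y => (f y).len) c.2) =
            h + weight (fun y => (f y).len) c.1 + (f x).len -
              ((f y).len + n + weight (fun y => (f y).len) c.2) := by omega
          simp [h1, e1, e2]
      have hnew : Hits f ((f y).len + n) i h y (letters u, 0) ↔ (f y).reach i h := by
        have e1 : i + n + (f y).len - ((f y).len + n) = i := by omega
        have e2 : h + n + (f y).len - ((f y).len + n) = h := by omega
        simp [Hits, ← hn, e1, e2]
      constructor
      · rintro (hr | ⟨h1, h2⟩ | ⟨x, c, hc, hr⟩)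
        · exact Or.inr ⟨y, _, mem_contrib_letter.2 (Or.inl ⟨rfl, rfl⟩), hnew.2 hr⟩
        · exact Or.inl ⟨by omega, by omega⟩
        · exact Or.inr ⟨x, c, mem_contrib_letter.2 (Or.inr hc), (key x c hc).1 hr⟩
      · rintro (⟨h1, h2⟩ | ⟨x, c, hc, hr⟩)
        · exact Or.inr (Or.inl ⟨by omega, by omega⟩)
        · rcases mem_contrib_letter.1 hc with ⟨rfl, rfl⟩ | hc
          · exact Or.inl (hnew.1 hr)
          · exact Or.inr (Or.inr ⟨x, c, hc, (key x c hc).2 hr⟩)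
    | idem w =>
      have hl : φ (toFreeUnary (FreeMonoid.of (ExtLetter.idem w))) =
          UnaryMonoid.plus (φ (FreeMonoid.lift FreeUnaryMonoid.of w)) := φ.map_plus _
      have hc : weight (fun y => (φ (FreeUnaryMonoid.of y)).len) (letters (.idem w :: u)) = n := rfl
      have hw := reach_word φ w.toList h
      rw [FreeMonoid.ofList_toList] at hw
      rw [hl, hc, Profile.reach_plus, Profile.len_plus, Nat.sub_zero, Nat.sub_zero, hw]
      have hnew : ∀ x ∈ w.toList, (Hits f n i h x (letters u, w.upTo x) ↔ i = 0 ∧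
          (f x).reach 0 (h + (f x).len - weight (fun y => (f y).len) (w.upTo x))) := by
        intro x hx
        have h1 : w.upTo x ≠ 0 := FreeMonoid.upTo_ne_zero hx
        have e2 : h + n + (f x).len - (n + weight (fun y => (f y).len) (w.upTo x)) =
          h + (f x).len - weight (fun y => (f y).len) (w.upTo x) := by omega
        simp [Hits, ← hn, h1, e2]
      constructor
      · rintro (⟨rfl, rfl | ⟨x, hx, hr⟩⟩ | hr | ⟨x, c, hc, hr⟩)
        · exact Or.inl ⟨by omega, by omega⟩
        · exact Or.inr ⟨x, _, mem_contrib_idem.2 (Or.inl ⟨hx, rfl⟩), (hnew x hx).2 ⟨rfl, hr⟩⟩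
        · exact Or.inl hr
        · exact Or.inr ⟨x, c, mem_contrib_idem.2 (Or.inr hc), hr⟩
      · rintro (hr | ⟨x, c, hc, hr⟩)
        · exact Or.inr (Or.inl hr)
        · rcases mem_contrib_idem.1 hc with ⟨hx, rfl⟩ | hc
          · obtain ⟨rfl, hr'⟩ := (hnew x hx).1 hr
            exact Or.inl ⟨rfl, Or.inr ⟨x, hx, hr'⟩⟩
          · exact Or.inr (Or.inr ⟨x, c, hc, hr⟩)

end eval

end NonNestedWord

/-! ## Identities as mutual domination of contributions -/

/-- The composite of two morphisms of unary monoids. -/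
def UnaryMonoidHom.comp {M N P : Type*} [UnaryMonoid M] [UnaryMonoid N] [UnaryMonoid P]
    (ψ : UnaryMonoidHom N P) (φ : UnaryMonoidHom M N) : UnaryMonoidHom M P where
  toMonoidHom := ψ.toMonoidHom.comp φ.toMonoidHom
  map_plus' m := (congrArg ψ (φ.map_plus m)).trans (ψ.map_plus _)

namespace NonNestedWord

/-- With the weights `ψ`, the contribution `c'` makes `c` redundant. -/
def Dom {S : Type*} (ψ : S → ℕ) (c' c : Multiset S × Multiset S) : Prop :=
  weight ψ c'.1 ≤ weight ψ c.1 ∧ weight ψ c.2 + weight ψ c'.1 ≤ weight ψ c'.2 + weight ψ c.1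

theorem Dom.trans {S : Type*} {ψ : S → ℕ} {a b c : Multiset S × Multiset S} (h : Dom ψ a b)
    (h' : Dom ψ b c) : Dom ψ a c := by
  obtain ⟨h1, h2⟩ := h
  obtain ⟨h3, h4⟩ := h'
  exact ⟨by omega, by omega⟩

/-- Every contribution in `C` is redundant in the presence of `C'`. -/
def Dominated {S : Type*} (ψ : S → ℕ) (C C' : List (Multiset S × Multiset S)) : Prop :=
  ∀ c ∈ C, ∃ c' ∈ C', Dom ψ c' c

variable {S : Type*} [DecidableEq S]

theorem Hits.of_dom {f : S → Profile} {u v : List (ExtLetter S)} {x : S}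
    {c c' : Multiset S × Multiset S} {i h : ℕ} (huv : letters u = letters v)
    (hc : c ∈ contrib x u) (hc' : c' ∈ contrib x v) (hd : Dom (fun y => (f y).len) c' c)
    (hh : Hits f (weight (fun y => (f y).len) (letters u)) i h x c) :
    Hits f (weight (fun y => (f y).len) (letters v)) i h x c' := by
  have hb := contrib_bounds hc
  have hb' := contrib_bounds hc'
  rw [← huv] at hb' ⊢
  unfold Hits at hh ⊢
  set ψ : S → ℕ := fun y => (f y).len with hψ
  have hx : (f x).len = ψ x := rfl
  obtain ⟨hd1, hd2⟩ := hd
  rcases hh with ⟨h0, hr⟩ | ⟨h0, hi, hr⟩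
  · rw [h0, weight_zero] at hd2
    rcases hb' with ⟨h0', hb'⟩ | ⟨h0', hb'⟩
    · exact Or.inl ⟨h0', (f x).down hr (by omega) (by omega)⟩
    · have hl := (f x).le_len hr
      have hne : c'.2 ≠ 0 := fun h => by simp [h] at h0'
      exact Or.inr ⟨hne, by omega, (f x).down hr (by omega) (by omega)⟩
  · rcases hb' with ⟨h0', hb'⟩ | ⟨h0', hb'⟩
    -- Here a letter replaces a copy inside some `w⁺`. Since `x` lies in `c.2`, its length is at
    -- most `weight ψ c.2`, so the domination inequality puts the start of the letter at or above
    -- `i`, and the index truncates to `0`.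
    · have hxc : x ∈ c.2 := by
        rcases hb with hb | hb
        · exact absurd hb.1 h0
        · exact hb.1
      have := le_weight_of_mem ψ hxc
      rw [h0', weight_zero] at hd2
      exact Or.inl ⟨h0', (f x).down hr (by omega) (by omega)⟩
    · have hne : c'.2 ≠ 0 := fun h => by simp [h] at h0'
      exact Or.inr ⟨hne, by omega, (f x).down hr (by omega) (by omega)⟩

theorem reach_of_dominated (φ : UnaryMonoidHom (FreeUnaryMonoid S) Profile)
    {u v : List (ExtLetter S)} (huv : letters u = letters v)
    (hd : ∀ x, Dominated (fun y => (φ (FreeUnaryMonoid.of y)).len) (contrib x u) (contrib x v))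
    {i h : ℕ} (hr : (φ (toFreeUnary (FreeMonoid.ofList u))).reach i h) :
    (φ (toFreeUnary (FreeMonoid.ofList v))).reach i h := by
  rw [reach_toFreeUnary] at hr ⊢
  rcases hr with hr | ⟨x, c, hc, hr⟩
  · exact Or.inl (huv ▸ hr)
  · obtain ⟨c', hc', h'⟩ := hd x c hc
    exact Or.inr ⟨x, c', hc', hr.of_dom (f := fun y => φ (FreeUnaryMonoid.of y)) huv hc hc' h'⟩

/-! ### Test substitutions: identities force domination. -/

omit [DecidableEq S] in
theorem satisfiesIdentity_iff_profile {s t : FreeUnaryMonoid S} :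
    SatisfiesIdentity (FLAd Unit) s t ↔ ∀ φ : UnaryMonoidHom (FreeUnaryMonoid S) (FLAd Unit),
      (FLAd.profile.comp φ) s = (FLAd.profile.comp φ) t :=
  ⟨fun h φ => congrArg FLAd.profile (h φ), fun h φ => FLAd.profile_injective (h φ)⟩

omit [DecidableEq S] in
/-- A substitution of given trunk lengths and branch lengths. -/
theorem exists_substitution (ψ δ : S → ℕ) :
    ∃ φ : UnaryMonoidHom (FreeUnaryMonoid S) (FLAd Unit), ∀ y,
      ((FLAd.profile.comp φ) (FreeUnaryMonoid.of y)).len = ψ y ∧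
      ∀ i h, ((FLAd.profile.comp φ) (FreeUnaryMonoid.of y)).reach i h ↔
        i ≤ ψ y ∧ h ≤ ψ y + δ y := by
  choose g hg1 hg2 using fun y => FLAd.exists_profile (ψ y) (δ y)
  exact ⟨FreeUnaryMonoid.lift g, fun y => ⟨hg1 y, hg2 y⟩⟩

theorem letters_eq_of_satisfiesIdentity {u v : List (ExtLetter S)}
    (h : SatisfiesIdentity (FLAd Unit) (toFreeUnary (FreeMonoid.ofList u))
      (toFreeUnary (FreeMonoid.ofList v))) : letters u = letters v := by
  ext y
  obtain ⟨φ, hφ⟩ := exists_substitution (fun z => if z = y then 1 else 0) (fun _ : S => 0)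
  have h1 := congrArg Profile.len (satisfiesIdentity_iff_profile.1 h φ)
  rw [len_toFreeUnary, len_toFreeUnary] at h1
  simp only [hφ] at h1
  have h2 : ∀ m : Multiset S, weight (fun z => if z = y then 1 else 0) m = m.count y := by
    intro m
    induction m using Multiset.induction with
    | empty => simp
    | cons z m ih =>
      rw [weight_cons, ih, Multiset.count_cons, add_comm]
      simp [eq_comm]
  rwa [h2, h2] at h1

theorem exists_weight_bound (ψ : S → ℕ) (v : List (ExtLetter S)) :
    ∃ K, ∀ y, ∀ c ∈ contrib y v, weight ψ c.2 ≤ K := by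
  induction v with
  | nil => exact ⟨0, fun y c hc => by simp [contrib] at hc⟩
  | cons l v ih =>
    obtain ⟨K, hK⟩ := ih
    cases l with
    | letter z =>
      refine ⟨K, fun y c hc => ?_⟩
      rcases mem_contrib_letter.1 hc with ⟨_, rfl⟩ | hc
      · simp
      · exact hK y c hc
    | idem w =>
      refine ⟨K + weight ψ (w.toList : Multiset S), fun y c hc => ?_⟩
      rcases mem_contrib_idem.1 hc with ⟨_, rfl⟩ | hc
      · have := weight_mono ψ (FreeMonoid.upTo_le w y)
        simp only
        omega
      · have := hK y c hc
        omega

theorem dominated_of_satisfiesIdentity {u v : List (ExtLetter S)}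
    (h : SatisfiesIdentity (FLAd Unit) (toFreeUnary (FreeMonoid.ofList u))
      (toFreeUnary (FreeMonoid.ofList v))) (ψ : S → ℕ) (x : S) :
    Dominated ψ (contrib x u) (contrib x v) := by
  intro c hc
  have huv := letters_eq_of_satisfiesIdentity h
  obtain ⟨K, hK⟩ := exists_weight_bound ψ v
  set n := weight ψ (letters u) with hn
  -- No height attained in `v` without this branch exceeds `n + K`, so a point above `n + K` can
  -- only come from a contribution of `x`.
  set L := n + K + 1 with hL
  obtain ⟨φ, hφ⟩ := exists_substitution ψ (fun y => if y = x then L else 0)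
  have hs := satisfiesIdentity_iff_profile.1 h φ
  set Φ := FLAd.profile.comp φ with hΦ
  have hlen : (fun y => (Φ (FreeUnaryMonoid.of y)).len) = ψ := funext fun y => (hφ y).1
  have hb := contrib_bounds hc
  have hle : weight ψ c.1 ≤ n := by
    rcases hb with ⟨_, hb⟩ | ⟨_, hb⟩
    · have := weight_mono ψ hb
      rw [weight_cons] at this
      omega
    · exact weight_mono ψ hb
  -- The tip of the long branch at the end of the copy of `x` planted by `c`, seen from the highest
  -- trunk vertex available to it. Hitting this point in `v` amounts to dominating `c`.
  have hr : (Φ (toFreeUnary (FreeMonoid.ofList u))).reach (n - weight ψ c.1)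
      (n - weight ψ c.1 + weight ψ c.2 + L) := by
    rw [reach_toFreeUnary]
    refine Or.inr ⟨x, c, hc, ?_⟩
    unfold Hits
    simp only [hlen, (hφ x).1, (hφ x).2, ← hn, if_true]
    by_cases h0 : c.2 = 0
    · simp only [h0, weight_zero]
      exact Or.inl ⟨trivial, by omega, by omega⟩
    · have h1 : x ∈ c.2 := by
        rcases hb with hb | hb
        · exact absurd hb.1 h0
        · exact hb.1
      have := le_weight_of_mem ψ h1
      exact Or.inr ⟨h0, by omega, by omega, by omega⟩
  rw [hs, reach_toFreeUnary] at hr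
  simp only [hlen, ← huv, ← hn] at hr
  rcases hr with hr | ⟨y, c', hc', hr⟩
  · omega
  · have hb' := contrib_bounds hc'
    rw [← huv] at hb'
    have hle' : weight ψ c'.1 ≤ n := by
      rcases hb' with ⟨_, hb⟩ | ⟨_, hb⟩
      · have := weight_mono ψ hb
        rw [weight_cons] at this
        omega
      · exact weight_mono ψ hb
    have hK' := hK y c' hc'
    unfold Hits at hr
    simp only [hlen, (hφ y).1, (hφ y).2] at hr
    by_cases hy : y = x
    · subst hy
      refine ⟨c', hc', ?_⟩
      rw [if_pos rfl] at hr
      rcases hr with ⟨h0, hr1, hr2⟩ | ⟨h0, hr1, hr2, hr3⟩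
      · refine ⟨by omega, ?_⟩
        rw [h0, weight_zero]
        omega
      · exact ⟨by omega, by omega⟩
    · rw [if_neg hy] at hr
      rcases hr with ⟨h0, hr1, hr2⟩ | ⟨h0, hr1, hr2, hr3⟩
      · omega
      · omega

/-- An identity between non-nested words holds in the monogenic free left adequate monoid if and
only if both sides have the same letters and their contributions dominate each other. -/
theorem satisfiesIdentity_iff_dominated {u v : List (ExtLetter S)} :
    SatisfiesIdentity (FLAd Unit) (toFreeUnary (FreeMonoid.ofList u))
      (toFreeUnary (FreeMonoid.ofList v)) ↔
      letters u = letters v ∧ ∀ ψ x, Dominated ψ (contrib x u) (contrib x v) ∧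
        Dominated ψ (contrib x v) (contrib x u) := by
  constructor
  · intro h
    exact ⟨letters_eq_of_satisfiesIdentity h, fun ψ x => ⟨dominated_of_satisfiesIdentity h ψ x,
      dominated_of_satisfiesIdentity (fun φ => (h φ).symm) ψ x⟩⟩
  · rintro ⟨h1, h2⟩
    rw [satisfiesIdentity_iff_profile]
    intro φ
    rw [Profile.ext_iff']
    refine ⟨by rw [len_toFreeUnary, len_toFreeUnary, h1], fun i h => ⟨?_, ?_⟩⟩
    · exact reach_of_dominated _ h1 fun x => (h2 _ x).1
    · exact reach_of_dominated _ h1.symm fun x => (h2 _ x).2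

/-! ## Reduction to non-nested words -/

omit [DecidableEq S] in
/-- The idempotent generated by a non-nested word is a product of `k⁺` with `k` a word. -/
theorem exists_idems (u : List (ExtLetter S)) :
    ∃ K : List (FreeMonoid S), K ≠ [] ∧
      ∀ φ : UnaryMonoidHom (FreeUnaryMonoid S) Profile, ∀ h,
        (φ (toFreeUnary (FreeMonoid.ofList u))).reach 0 h ↔
          ∃ k ∈ K, (φ (FreeMonoid.lift FreeUnaryMonoid.of k)).reach 0 h := by
  induction u with
  | nil => exact ⟨[1], by simp, fun φ h => by simp⟩
  | cons l u ih =>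
    obtain ⟨K, hK0, hK⟩ := ih
    cases l with
    | letter y =>
      -- Prefixing `y` lifts every branch `k` by the tree of `y`. The branches of `y` itself are
      -- carried along by any member of `K`, hence the requirement that `K` be nonempty.
      refine ⟨K.map (FreeMonoid.of y * ·), by simpa using hK0, fun φ h => ?_⟩
      have e : toFreeUnary (FreeMonoid.of (ExtLetter.letter y)) = FreeUnaryMonoid.of y := rfl
      simp only [FreeMonoid.ofList_cons, _root_.map_mul, φ.map_mul, Profile.reach_mul,
        Nat.zero_sub, hK, e, List.mem_map, exists_exists_and_eq_and, FreeMonoid.lift_eval_of]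
      constructor
      · rintro (hr | ⟨k, hk, hr⟩)
        · obtain ⟨k, hk⟩ := List.exists_mem_of_ne_nil K hK0
          exact ⟨k, hk, Or.inl hr⟩
        · exact ⟨k, hk, Or.inr hr⟩
      · rintro ⟨k, hk, hr | hr⟩
        · exact Or.inl hr
        · exact Or.inr ⟨k, hk, hr⟩
    | idem w =>
      refine ⟨w :: K, by simp, fun φ h => ?_⟩
      have e : toFreeUnary (FreeMonoid.of (ExtLetter.idem w)) =
        UnaryMonoid.plus (FreeMonoid.lift FreeUnaryMonoid.of w) := rfl
      simp [FreeMonoid.ofList_cons, φ.map_mul, Profile.reach_mul, hK, e, φ.map_plus,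
        Profile.reach_plus, Profile.len_plus]

omit [DecidableEq S] in
theorem toFreeUnary_idems (K : List (FreeMonoid S)) (hK : K ≠ [])
    (φ : UnaryMonoidHom (FreeUnaryMonoid S) Profile) :
    (φ (toFreeUnary (FreeMonoid.ofList (K.map ExtLetter.idem)))).len = 0 ∧ ∀ i h,
      ((φ (toFreeUnary (FreeMonoid.ofList (K.map ExtLetter.idem)))).reach i h ↔
        i = 0 ∧ ∃ k ∈ K, (φ (FreeMonoid.lift FreeUnaryMonoid.of k)).reach 0 h) := by
  induction K with
  | nil => exact absurd rfl hK
  | cons w K ih =>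
    have e : toFreeUnary (FreeMonoid.of (ExtLetter.idem w)) =
        UnaryMonoid.plus (FreeMonoid.lift FreeUnaryMonoid.of w) := rfl
    rw [List.map_cons, FreeMonoid.ofList_cons, _root_.map_mul, φ.map_mul, e, φ.map_plus]
    rcases eq_or_ne K [] with rfl | h0
    · rw [List.map_nil, FreeMonoid.ofList_nil, _root_.map_one, φ.map_one, mul_one]
      simp [Profile.reach_plus, Profile.len_plus]
    · obtain ⟨h1, h2⟩ := ih h0
      refine ⟨by rw [Profile.len_mul, h1, Profile.len_plus], fun i h => ?_⟩
      rw [Profile.reach_mul, Profile.len_plus, Nat.sub_zero, Nat.sub_zero, h2, Profile.reach_plus]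
      simp only [List.mem_cons, exists_eq_or_imp]
      tauto

omit [DecidableEq S] in
theorem exists_nonNested (s : FreeUnaryMonoid S) :
    ∃ u : NonNestedWord S, SatisfiesIdentity (FLAd Unit) s u.toFreeUnary := by
  induction s using FreeUnaryMonoid.induction with
  | var x => exact ⟨FreeMonoid.of (.letter x), fun φ => rfl⟩
  | one => exact ⟨1, fun φ => by rw [_root_.map_one toFreeUnary]⟩
  | mul s t hs ht =>
    obtain ⟨u, hu⟩ := hs
    obtain ⟨v, hv⟩ := ht
    exact ⟨u * v, fun φ => by rw [_root_.map_mul toFreeUnary, φ.map_mul, φ.map_mul, hu φ, hv φ]⟩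
  | plus s hs =>
    obtain ⟨u, hu⟩ := hs
    obtain ⟨K, hK0, hK⟩ := exists_idems u.toList
    refine ⟨FreeMonoid.ofList (K.map ExtLetter.idem), fun φ => FLAd.profile_injective ?_⟩
    obtain ⟨h1, h2⟩ := toFreeUnary_idems K hK0 (FLAd.profile.comp φ)
    rw [φ.map_plus, hu φ, FLAd.profile.map_plus]
    change UnaryMonoid.plus ((FLAd.profile.comp φ) (toFreeUnary u)) = (FLAd.profile.comp φ) _
    rw [Profile.ext_iff']
    refine ⟨h1.symm, fun i h => ?_⟩
    rw [h2, Profile.reach_plus, ← hK, FreeMonoid.ofList_toList]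

end NonNestedWord

/-! ## Generic weights -/

section generic

variable {S : Type*}

theorem weight_eq_sum [DecidableEq S] (ψ : S → ℕ) {m : Multiset S} {T : Finset S}
    (h : m.toFinset ⊆ T) : weight ψ m = ∑ y ∈ T, m.count y * ψ y := by
  rw [weight, Finset.sum_multiset_map_count]
  simp only [smul_eq_mul]
  refine Finset.sum_subset h fun y _ hy => ?_
  rw [Multiset.mem_toFinset] at hy
  rw [Multiset.count_eq_zero_of_notMem hy, zero_mul]

theorem weight_linear (ψ η : S → ℕ) (N : ℕ) (m : Multiset S) :
    weight (fun y => N * ψ y + η y) m = N * weight ψ m + weight η m := by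
  induction m using Multiset.induction with
  | empty => simp
  | cons y m ih => rw [weight_cons, weight_cons, weight_cons, ih]; ring

theorem eq_zero_of_weight_eq_zero {ψ : S → ℕ} (hψ : ∀ y, 0 < ψ y) {m : Multiset S}
    (h : weight ψ m = 0) : m = 0 := by
  refine Multiset.eq_zero_of_forall_notMem fun y hy => ?_
  have := le_weight_of_mem ψ hy
  have := hψ y
  omega

theorem eq_of_le_of_weight_le {ψ : S → ℕ} (hψ : ∀ y, 0 < ψ y) {m m' : Multiset S} (h : m ≤ m')
    (h' : weight ψ m' ≤ weight ψ m) : m = m' := by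
  obtain ⟨r, rfl⟩ := Multiset.le_iff_exists_add.1 h
  rw [weight_add] at h'
  rw [eq_zero_of_weight_eq_zero hψ (m := r) (by omega), add_zero]

/-- Positive weights that separate the bounded vectors on a finite set. -/
theorem exists_separating [DecidableEq S] (B : ℕ) (T : Finset S) :
    ∃ η : S → ℕ, (∀ y, 0 < η y) ∧ ∀ f g : S → ℕ, (∀ y ∈ T, f y ≤ B) → (∀ y ∈ T, g y ≤ B) →
      ∑ y ∈ T, f y * η y = ∑ y ∈ T, g y * η y → ∀ y ∈ T, f y = g y := by
  induction T using Finset.induction with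
  | empty => exact ⟨fun _ => 1, by simp, by simp⟩
  | insert z T hz ih =>
    obtain ⟨η, h1, h2⟩ := ih
    -- Expansion in base `B + 1`: the new coordinate is the lowest digit, and the old sum is the
    -- quotient.
    refine ⟨fun y => if y = z then 1 else (B + 1) * η y, fun y => ?_, fun f g hf hg h => ?_⟩
    · have := h1 y
      dsimp only
      split_ifs
      · exact one_pos
      · positivity
    · have key : ∀ f : S → ℕ, ∑ y ∈ insert z T, f y * (if y = z then 1 else (B + 1) * η y) =
          f z + (B + 1) * ∑ y ∈ T, f y * η y := by
        intro f
        rw [Finset.sum_insert hz, if_pos rfl, mul_one, Finset.mul_sum]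
        congr 1
        refine Finset.sum_congr rfl fun y hy => ?_
        rw [if_neg (by rintro rfl; exact hz hy)]
        ring
      rw [key, key] at h
      have hfz := hf z (Finset.mem_insert_self _ _)
      have hgz := hg z (Finset.mem_insert_self _ _)
      have hm := congrArg (· % (B + 1)) h
      simp only [Nat.add_mul_mod_self_left] at hm
      rw [Nat.mod_eq_of_lt (by omega), Nat.mod_eq_of_lt (by omega)] at hm
      have hs : ∑ y ∈ T, f y * η y = ∑ y ∈ T, g y * η y := by
        rw [hm] at h
        exact Nat.eq_of_mul_eq_mul_left (Nat.succ_pos B) (Nat.add_left_cancel h)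
      intro y hy
      rcases Finset.mem_insert.1 hy with rfl | hy
      · exact hm
      · exact h2 f g (fun y hy => hf y (Finset.mem_insert_of_mem hy))
          (fun y hy => hg y (Finset.mem_insert_of_mem hy)) hs y hy

/-- Every weight function can be perturbed to a positive one that separates the submultisets of a
given multiset. -/
theorem exists_perturbation [DecidableEq S] (ψ₀ : S → ℕ) (m₀ : Multiset S) :
    ∃ ψ : S → ℕ, (∀ y, 0 < ψ y) ∧ ∀ m m', m ≤ m₀ → m' ≤ m₀ →
      (weight ψ m = weight ψ m' → m = m') ∧
      (weight ψ m ≤ weight ψ m' → weight ψ₀ m ≤ weight ψ₀ m') := by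
  obtain ⟨η, h1, h2⟩ := exists_separating m₀.card m₀.toFinset
  -- The factor exceeds the `η`-weight of every submultiset of `m₀`. Thus `ψ₀` decides comparisons
  -- first, and the `η`-weight survives as the remainder modulo this factor.
  refine ⟨fun y => (weight η m₀ + 1) * ψ₀ y + η y, fun y => by have := h1 y; positivity,
    fun m m' hm hm' => ?_⟩
  rw [weight_linear, weight_linear]
  have hw := weight_mono η hm
  have hw' := weight_mono η hm'
  constructor
  · intro h
    have h3 := congrArg (· % (weight η m₀ + 1)) h
    simp only [Nat.mul_add_mod] at h3
    rw [Nat.mod_eq_of_lt (by omega), Nat.mod_eq_of_lt (by omega),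
      weight_eq_sum η (Multiset.toFinset_subset.2 (Multiset.subset_of_le hm)),
      weight_eq_sum η (Multiset.toFinset_subset.2 (Multiset.subset_of_le hm'))] at h3
    have h4 := h2 (fun y => m.count y) (fun y => m'.count y)
      (fun y _ => (Multiset.count_le_card y m).trans (Multiset.card_le_card hm))
      (fun y _ => (Multiset.count_le_card y m').trans (Multiset.card_le_card hm')) h3
    ext y
    by_cases hy : y ∈ m₀
    · exact h4 y (Multiset.mem_toFinset.2 hy)
    · rw [Multiset.count_eq_zero_of_notMem fun h => hy (Multiset.mem_of_le hm h),
        Multiset.count_eq_zero_of_notMem fun h => hy (Multiset.mem_of_le hm' h)]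
  · intro h
    by_contra! hlt
    have := Nat.mul_le_mul_left (weight η m₀ + 1) (Nat.succ_le_of_lt hlt)
    rw [Nat.mul_succ] at this
    omega

end generic

/-! ## Corners -/

namespace NonNestedWord

section corner

variable {S : Type*}

/-- With the weights `ψ`, nothing else in `C` makes `c` redundant. -/
def Corner (ψ : S → ℕ) (C : List (Multiset S × Multiset S)) (c : Multiset S × Multiset S) : Prop :=
  c ∈ C ∧ ∀ c' ∈ C, Dom ψ c' c → c' = c

/-- The weights `ψ` separate the members of `C`. -/
def Separates (ψ : S → ℕ) (C : List (Multiset S × Multiset S)) : Prop :=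
  ∀ c ∈ C, ∀ c' ∈ C, weight ψ c.1 = weight ψ c'.1 → weight ψ c.2 = weight ψ c'.2 → c = c'

/-- Domination for the perturbed weights implies domination for the original ones, so it suffices to
treat positive separating weights. -/
theorem exists_generic [DecidableEq S] (ψ₀ : S → ℕ) (C : List (Multiset S × Multiset S)) :
    ∃ ψ : S → ℕ, (∀ y, 0 < ψ y) ∧ Separates ψ C ∧
      ∀ c ∈ C, ∀ c' ∈ C, Dom ψ c' c → Dom ψ₀ c' c := by
  have hC : ∃ m₀ : Multiset S, ∀ c ∈ C, c.1 ≤ m₀ ∧ c.2 ≤ m₀ := by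
    induction C with
    | nil => exact ⟨0, by simp⟩
    | cons d C ih =>
      obtain ⟨m₀, h⟩ := ih
      refine ⟨m₀ + (d.1 + d.2), fun c hc => ?_⟩
      rcases List.mem_cons.1 hc with rfl | hc
      · exact ⟨(Multiset.le_add_right _ _).trans (Multiset.le_add_left _ _),
          (Multiset.le_add_left _ _).trans (Multiset.le_add_left _ _)⟩
      · exact ⟨(h c hc).1.trans (Multiset.le_add_right _ _),
          (h c hc).2.trans (Multiset.le_add_right _ _)⟩
  obtain ⟨m₀, h⟩ := hC
  -- Twice `m₀`, since the second inequality of `Dom` compares sums of two components.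
  obtain ⟨ψ, h1, h2⟩ := exists_perturbation ψ₀ (m₀ + m₀)
  have hl : ∀ m, m ≤ m₀ → m ≤ m₀ + m₀ := fun m hm => hm.trans (Multiset.le_add_right _ _)
  refine ⟨ψ, h1, fun c hc c' hc' e1 e2 => ?_, fun c hc c' hc' hd => ?_⟩
  · exact Prod.ext ((h2 _ _ (hl _ (h c hc).1) (hl _ (h c' hc').1)).1 e1)
      ((h2 _ _ (hl _ (h c hc).2) (hl _ (h c' hc').2)).1 e2)
  · obtain ⟨d1, d2⟩ := hd
    refine ⟨(h2 _ _ (hl _ (h c' hc').1) (hl _ (h c hc).1)).2 d1, ?_⟩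
    rw [← weight_add, ← weight_add] at d2 ⊢
    exact (h2 _ _ (add_le_add (h c hc).2 (h c' hc').1) (add_le_add (h c' hc').2 (h c hc).1)).2 d2

theorem exists_corner [DecidableEq S] {ψ : S → ℕ} {C : List (Multiset S × Multiset S)}
    (hs : Separates ψ C) {c : Multiset S × Multiset S} (hc : c ∈ C) :
    ∃ c', Corner ψ C c' ∧ Dom ψ c' c := by
  classical
  -- The functional is the attained height minus `weight ψ d.1`, up to a constant. It grows strictly
  -- whenever a different point dominates, so a maximum among the dominators of `c` is a corner.
  obtain ⟨d, hd, hmax⟩ := Finset.exists_max_image (C.toFinset.filter fun d => Dom ψ d c)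
    (fun d => (weight ψ d.2 : ℤ) - 2 * weight ψ d.1)
    ⟨c, Finset.mem_filter.2 ⟨List.mem_toFinset.2 hc, le_rfl, le_rfl⟩⟩
  simp only [Finset.mem_filter, List.mem_toFinset] at hd hmax
  refine ⟨d, ⟨hd.1, fun e he hed => ?_⟩, hd.2⟩
  have h1 := hmax e ⟨he, hed.trans hd.2⟩
  obtain ⟨h2, h3⟩ := hed
  exact hs e he d hd.1 (by omega) (by omega)

/-- Going from `C` to `C'` and back dominates the corner again, so it returns to the corner itself.
Both inequalities are then equalities, and separation identifies the intermediate point. -/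
theorem Corner.transfer {ψ : S → ℕ} {C C' : List (Multiset S × Multiset S)}
    {c : Multiset S × Multiset S} (hc : Corner ψ C c) (hs : Separates ψ (C ++ C'))
    (h : Dominated ψ C C') (h' : Dominated ψ C' C) : Corner ψ C' c := by
  have key : ∀ d ∈ C', Dom ψ d c → d = c := by
    intro d hd hdc
    obtain ⟨e, he, hed⟩ := h' d hd
    obtain rfl := hc.2 e he (hed.trans hdc)
    obtain ⟨h1, h2⟩ := hdc
    obtain ⟨h3, h4⟩ := hed
    exact hs d (List.mem_append_right _ hd) e (List.mem_append_left _ he) (by omega) (by omega)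
  obtain ⟨d, hd, hdc⟩ := h c hc.1
  exact ⟨key d hd hdc ▸ hd, key⟩

end corner

end NonNestedWord

/-! ## Occurrences and suffixes -/

namespace List

variable {α : Type*}

theorem suffix_of_cons_suffix {l : α} {s u : List α} (h : l :: s <:+ u) : s <:+ u :=
  (List.suffix_cons l s).trans h

/-- Two suffixes are comparable; here each is given with its first letter. -/
theorem cons_suffix_trichotomy {l l' : α} {s s' u : List α} (h : l :: s <:+ u)
    (h' : l' :: s' <:+ u) : l :: s <:+ s' ∨ l' :: s' <:+ s ∨ (l = l' ∧ s = s') := by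
  rcases List.suffix_or_suffix_of_suffix h h' with h | h
  · rcases List.suffix_cons_iff.1 h with h | h
    · exact Or.inr (Or.inr (by simpa using h))
    · exact Or.inl h
  · rcases List.suffix_cons_iff.1 h with h | h
    · exact Or.inr (Or.inr (by simpa [eq_comm] using h))
    · exact Or.inr (Or.inl h)

/-- Lets any occurrence be replaced by the last one, which has the least content to its right and
hence dominates. -/
theorem last_suffix {l : α} {s a u : List α} (h : l :: s <:+ u) (ha : l :: a <:+ u)
    (hl : l ∉ a) : a <:+ s := by
  rcases cons_suffix_trichotomy h ha with h | h | ⟨_, rfl⟩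
  · exact absurd (h.subset List.mem_cons_self) hl
  · exact suffix_of_cons_suffix h
  · exact List.suffix_rfl

end List

namespace NonNestedWord

variable {S : Type*} [DecidableEq S]

omit [DecidableEq S] in
theorem letters_append (p s : List (ExtLetter S)) :
    letters (p ++ s) = letters p + letters s := by
  induction p with
  | nil => simp [letters]
  | cons l p ih => cases l <;> simp [letters, ih]

omit [DecidableEq S] in
theorem letters_mono {s u : List (ExtLetter S)} (h : s <:+ u) : letters s ≤ letters u := by
  obtain ⟨p, rfl⟩ := h
  rw [letters_append]
  exact Multiset.le_add_left _ _

omit [DecidableEq S] in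
theorem cons_letters_le {x : S} {s u : List (ExtLetter S)} (h : .letter x :: s <:+ u) :
    x ::ₘ letters s ≤ letters u := letters_mono h

theorem count_letters (u : List (ExtLetter S)) (x : S) :
    (letters u).count x = u.count (.letter x) := by
  induction u with
  | nil => rfl
  | cons l u ih =>
    cases l with
    | letter y =>
      rcases eq_or_ne x y with rfl | h
      · simp [letters, ih]
      · rw [letters, Multiset.count_cons_of_ne h, List.count_cons_of_ne (by simpa using h.symm), ih]
    | idem w => simp [letters, ih]

theorem mem_letters {u : List (ExtLetter S)} {x : S} : x ∈ letters u ↔ .letter x ∈ u := by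
  rw [← Multiset.count_pos, count_letters, List.count_pos_iff]

theorem occ_letter (u : NonNestedWord S) (x : S) :
    u.occ (.letter x) = (letters u.toList).count x := by
  rw [count_letters]; rfl

omit [DecidableEq S] in
theorem coe_erase (u : List (ExtLetter S)) :
    ((erase (FreeMonoid.ofList u)).toList : Multiset S) = letters u := by
  induction u with
  | nil => rfl
  | cons l u ih =>
    rw [FreeMonoid.ofList_cons, map_mul, FreeMonoid.toList_mul, ← Multiset.coe_add, ih]
    cases l with
    | letter y => exact Multiset.singleton_add _ _
    | idem w => exact zero_add _

theorem mem_contrib {x : S} {u : List (ExtLetter S)} {c : Multiset S × Multiset S} :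
    c ∈ contrib x u ↔ (∃ s, .letter x :: s <:+ u ∧ c = (letters s, 0)) ∨
      (∃ w s, .idem w :: s <:+ u ∧ x ∈ w.toList ∧ c = (letters s, w.upTo x)) := by
  induction u with
  | nil => simp [contrib]
  | cons l u ih =>
    cases l with
    | letter y =>
      rw [mem_contrib_letter, ih]
      simp only [List.suffix_cons_iff, List.cons.injEq, ExtLetter.letter.injEq, reduceCtorEq,
        false_and, false_or, or_and_right, exists_or, and_assoc, exists_and_left, exists_eq_left,
        or_assoc]
    | idem z =>
      rw [mem_contrib_idem, ih]
      simp only [List.suffix_cons_iff, List.cons.injEq, ExtLetter.idem.injEq, reduceCtorEq,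
        false_and, false_or, or_and_right, exists_or, and_assoc, exists_and_left, exists_eq_left]
      exact or_left_comm

theorem mem_contrib_of_suffix {x : S} {s u : List (ExtLetter S)} {c : Multiset S × Multiset S}
    (h : s <:+ u) (hc : c ∈ contrib x s) : c ∈ contrib x u := by
  rw [mem_contrib] at hc ⊢
  rcases hc with ⟨a, h1, h2⟩ | ⟨w, a, h1, h2⟩
  · exact Or.inl ⟨a, h1.trans h, h2⟩
  · exact Or.inr ⟨w, a, h1.trans h, h2⟩

omit [DecidableEq S] in
theorem exists_last_suffix {u : List (ExtLetter S)} {l : ExtLetter S} (h : l ∈ u) :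
    ∃ a, l :: a <:+ u ∧ l ∉ a := by
  obtain ⟨p, a, rfl, h'⟩ := List.exists_eq_append_cons_last h
  exact ⟨a, List.suffix_append _ _, h'⟩

theorem toList_afterLast_of_suffix {u : NonNestedWord S} {l : ExtLetter S}
    {a : List (ExtLetter S)} (h : l :: a <:+ u.toList) (ha : l ∉ a) :
    (u.afterLast l).toList = a := by
  obtain ⟨p, hp⟩ := h
  exact FreeMonoid.toList_afterLast hp.symm ha

theorem toList_suff_letter {u : NonNestedWord S} {x : S} {a : List (ExtLetter S)}
    (h : .letter x :: a <:+ u.toList) (ha : .letter x ∉ a) :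
    (u.suff (.letter x)).toList = .letter x :: a := by
  rw [suff, FreeMonoid.toList_mul, toList_afterLast_of_suffix h ha, FreeMonoid.toList_of]
  rfl

omit [DecidableEq S] in
theorem letters_eq_zero {b : List (ExtLetter S)} (h : ∀ l ∈ b, l.isIdem = true) :
    letters b = 0 := by
  induction b with
  | nil => rfl
  | cons l b ih =>
    cases l with
    | letter y => simpa [ExtLetter.isIdem] using h (.letter y) List.mem_cons_self
    | idem w => exact ih fun l hl => h l (List.mem_cons_of_mem _ hl)

omit [DecidableEq S] in
theorem isIdem_of_letters_eq_zero {b : List (ExtLetter S)} (h : letters b = 0) :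
    ∀ l ∈ b, l.isIdem = true := by
  induction b with
  | nil => simp
  | cons l b ih =>
    cases l with
    | letter y => simp [letters] at h
    | idem w =>
      intro l hl
      rcases List.mem_cons.1 hl with rfl | hl
      · rfl
      · exact ih h l hl

/-- The suffix attached to `w⁺`: it starts with a maximal block of symbols `k⁺`, which contains the
last `w⁺`. -/
theorem suff_idem_spec {u : NonNestedWord S} {w : FreeMonoid S} {a : List (ExtLetter S)}
    (h : .idem w :: a <:+ u.toList) (ha : .idem w ∉ a) :
    (u.suff (.idem w)).toList <:+ u.toList ∧ .idem w ∈ (u.suff (.idem w)).toList ∧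
      letters (u.suff (.idem w)).toList = letters a ∧
      ∀ k, ¬ .idem k :: (u.suff (.idem w)).toList <:+ u.toList := by
  have haft := toList_afterLast_of_suffix h ha
  obtain ⟨p, hp⟩ := h
  have hmp : (u.mp (.idem w)).toList = p ++ [.idem w] := FreeMonoid.toList_mp hp.symm ha
  have hs : (u.suff (.idem w)).toList =
      (p ++ [ExtLetter.idem w]).rtakeWhile ExtLetter.isIdem ++ a := by
    rw [suff, FreeMonoid.toList_mul, haft, hmp]
    rfl
  have hu : u.toList = (p ++ [ExtLetter.idem w]).rdropWhile ExtLetter.isIdem ++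
      (u.suff (.idem w)).toList := by
    rw [hs, ← List.append_assoc, List.rdropWhile_append_rtakeWhile, ← hp, List.append_assoc]
    rfl
  refine ⟨⟨_, hu.symm⟩, ?_, ?_, ?_⟩
  · rw [hs, List.rtakeWhile_concat_pos _ _ _ rfl]
    simp
  · rw [hs, letters_append, letters_eq_zero fun l hl => List.mem_rtakeWhile_imp hl, zero_add]
  -- A symbol `k⁺` directly to the left would have belonged to the block: what remains after
  -- removing a maximal block does not end in such a symbol.
  · rintro k ⟨q, hq⟩
    have e : (p ++ [ExtLetter.idem w]).rdropWhile ExtLetter.isIdem = q ++ [.idem k] := by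
      refine (List.append_cancel_right (bs := (u.suff (.idem w)).toList) ?_)
      rw [← hu, ← hq, List.append_assoc]
      rfl
    have hne : (p ++ [ExtLetter.idem w]).rdropWhile ExtLetter.isIdem ≠ [] := by rw [e]; simp
    have := List.rdropWhile_last_not _ _ hne
    simp [e, ExtLetter.isIdem] at this

/-! ## The set `R` and domination -/

omit [DecidableEq S] in
theorem toList_ofWord_mul_of (p k : FreeMonoid S) :
    (ofWord p * FreeMonoid.of (ExtLetter.idem k)).toList =
      p.toList.map ExtLetter.letter ++ [.idem k] := by
  rw [FreeMonoid.toList_mul, ofWord, FreeMonoid.toList_map, FreeMonoid.toList_of]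

omit [DecidableEq S] in
theorem ofWord_mul_of_inj {p k p' k' : FreeMonoid S}
    (h : ofWord p * FreeMonoid.of (ExtLetter.idem k) =
      ofWord p' * FreeMonoid.of (ExtLetter.idem k')) : p = p' ∧ k = k' := by
  have h1 := congrArg FreeMonoid.toList h
  rw [toList_ofWord_mul_of, toList_ofWord_mul_of] at h1
  obtain ⟨h2, h3⟩ := List.append_inj' h1 rfl
  refine ⟨FreeMonoid.toList.injective
    (List.map_injective_iff.2 (fun x y h => ExtLetter.letter.inj h) h2), ?_⟩
  simpa using h3

omit [DecidableEq S] in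
theorem ofWord_mul_of_eq_of {p k k' : FreeMonoid S}
    (h : ofWord p * FreeMonoid.of (ExtLetter.idem k) = FreeMonoid.of (ExtLetter.idem k')) :
    p = 1 ∧ k = k' := by
  refine ofWord_mul_of_inj (p' := 1) ?_
  rw [h, map_one, one_mul]

theorem upTo_eq_of_count {w k : FreeMonoid S} {x x' : S}
    (h : ∀ y, (w.mp x).occ y = (k.mp x').occ y) : w.upTo x = k.upTo x' := by
  ext y
  rw [← FreeMonoid.occ_mp, ← FreeMonoid.occ_mp, h]

omit [DecidableEq S] in
theorem eq_one_of_coe_eq_zero {p : FreeMonoid S} (h : (p.toList : Multiset S) = 0) : p = 1 :=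
  FreeMonoid.toList.injective (by simpa using h)

theorem coe_erase_mp {s : NonNestedWord S} {l : ExtLetter S} {p a : List (ExtLetter S)}
    (h : s.toList = p ++ l :: a) (ha : l ∉ a) :
    ((erase (s.mp l)).toList : Multiset S) = letters (p ++ [l]) := by
  rw [← coe_erase, ← FreeMonoid.toList_mp h ha, FreeMonoid.ofList_toList]

theorem upTo_erase_mul_one {s : NonNestedWord S} {x : S} {p a : List (ExtLetter S)}
    (h : s.toList = p ++ .letter x :: a) (ha : .letter x ∉ a) :
    (erase s * 1).upTo x = x ::ₘ letters p := by
  rw [mul_one, FreeMonoid.upTo_eq (p := (erase (FreeMonoid.ofList p)).toList)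
    (s := (erase (FreeMonoid.ofList a)).toList), coe_erase]
  · have h1 : s = FreeMonoid.ofList p * (FreeMonoid.of (.letter x) * FreeMonoid.ofList a) := by
      apply FreeMonoid.toList.injective
      rw [h]
      rfl
    rw [h1, map_mul erase, map_mul erase, FreeMonoid.toList_mul, FreeMonoid.toList_mul]
    rfl
  · rwa [← Multiset.mem_coe, coe_erase, mem_letters]

/-- The prefix `p` is the content of the suffix before `k⁺`, so both sides of the last equation
count the suffix together with `mp_k(x)` (or only the suffix, for a letter). Through this equation,
comparing `mp_w(x)` with `mp_{pk}(x)` becomes the second inequality of `Dom`. -/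
theorem exists_contrib_of_mem_setR {u : NonNestedWord S} {w : FreeMonoid S} {x : S}
    (hw : .idem w ∈ u.toList) (hx : x ∈ w.toList) {p k : FreeMonoid S}
    (h : ofWord p * FreeMonoid.of (ExtLetter.idem k) ∈ u.setR w x) :
    ∃ c ∈ contrib x u.toList, c ≠ (letters (u.suff (.idem w)).toList, w.upTo x) ∧
      c.1 ≤ letters (u.suff (.idem w)).toList ∧
      (p * k).upTo x + c.1 = c.2 + letters (u.suff (.idem w)).toList := by
  obtain ⟨a, ha, ha'⟩ := exists_last_suffix hw
  obtain ⟨hsu, -, -, -⟩ := suff_idem_spec ha ha'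
  obtain ⟨hq, hn⟩ := h
  rcases hq with ⟨k', hk, hxk, he⟩ | ⟨hxs, he⟩
  · obtain ⟨rfl, rfl⟩ := ofWord_mul_of_inj he
    change .idem k ∈ (u.suff (.idem w)).toList at hk
    change x ∈ k.toList at hxk
    obtain ⟨p1, a1, h1, h2⟩ := List.exists_eq_append_cons_last hk
    have hp := coe_erase_mp h1 h2
    have hs1 : letters (u.suff (.idem w)).toList = letters p1 + letters a1 := by
      rw [h1, letters_append]; rfl
    have hp1 : letters (p1 ++ [ExtLetter.idem k]) = letters p1 := by
      rw [letters_append]; exact add_zero _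
    rw [hp1] at hp
    refine ⟨(letters a1, k.upTo x), mem_contrib_of_suffix hsu (mem_contrib.2 (Or.inr
      ⟨k, a1, ⟨p1, h1.symm⟩, hxk, rfl⟩)), ?_, ?_, ?_⟩
    -- Equality with the contribution of `w⁺` would make `p` empty and the two prefix contents
    -- equal, which is exactly the case removed in passing from `Q` to `R`.
    · intro hc
      obtain ⟨e1, e2⟩ := Prod.ext_iff.1 hc
      simp only at e1 e2
      rw [hs1, right_eq_add] at e1
      refine hn ⟨k, ?_, fun y => ?_⟩
      · rw [eq_one_of_coe_eq_zero (hp.trans e1), map_one, one_mul]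
      · rw [FreeMonoid.occ_mp, FreeMonoid.occ_mp, e2]
    · rw [hs1]
      exact Multiset.le_add_left _ _
    · rw [FreeMonoid.upTo_of_mul_of_mem _ hxk, hp, hs1]
      dsimp only
      abel
  · obtain ⟨rfl, rfl⟩ := ofWord_mul_of_inj he
    change .letter x ∈ (u.suff (.idem w)).toList at hxs
    obtain ⟨p1, a1, h1, h2⟩ := List.exists_eq_append_cons_last hxs
    have hs1 : letters (u.suff (.idem w)).toList = x ::ₘ letters p1 + letters a1 := by
      rw [h1, letters_append, letters, Multiset.add_cons, Multiset.cons_add]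
    refine ⟨(letters a1, 0), mem_contrib_of_suffix hsu (mem_contrib.2 (Or.inl
      ⟨a1, ⟨p1, h1.symm⟩, rfl⟩)), ?_, ?_, ?_⟩
    · intro hc
      exact FreeMonoid.upTo_ne_zero hx (Prod.ext_iff.1 hc).2.symm
    · rw [hs1]
      exact Multiset.le_add_left _ _
    · rw [upTo_erase_mul_one h1 h2, hs1, zero_add]

/-- For positive weights a dominating occurrence cannot have more content to its right than the
suffix, so it lies inside the suffix. Passing to its last copy gives a dominator `d` of the shape
recorded by `R`. -/
theorem exists_mem_setR_of_dom {u : NonNestedWord S} {w : FreeMonoid S} {x : S}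
    (hw : .idem w ∈ u.toList) (hx : x ∈ w.toList) {ψ : S → ℕ} (hψ : ∀ y, 0 < ψ y)
    {c : Multiset S × Multiset S} (hc : c ∈ contrib x u.toList)
    (hne : c ≠ (letters (u.suff (.idem w)).toList, w.upTo x))
    (hd : Dom ψ c (letters (u.suff (.idem w)).toList, w.upTo x)) :
    ∃ p k, ofWord p * FreeMonoid.of (ExtLetter.idem k) ∈ u.setR w x ∧
      ∃ d ∈ contrib x u.toList, Dom ψ d (letters (u.suff (.idem w)).toList, w.upTo x) ∧
      (p * k).upTo x + d.1 = d.2 + letters (u.suff (.idem w)).toList := by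
  obtain ⟨a, ha, ha'⟩ := exists_last_suffix hw
  obtain ⟨hsu, -, -, hmax⟩ := suff_idem_spec ha ha'
  set s := u.suff (.idem w) with hs
  obtain ⟨hd1, hd2⟩ := hd
  have hpos : 0 < weight ψ (w.upTo x) :=
    lt_of_lt_of_le (hψ x) (le_weight_of_mem ψ (FreeMonoid.mem_upTo hx))
  simp only at hd1 hd2
  rcases mem_contrib.1 hc with ⟨s1, h1, rfl⟩ | ⟨k, s1, h1, hxk, rfl⟩
  · simp only [weight_zero, zero_add] at hd1 hd2
    have hxs : .letter x :: s1 <:+ s.toList := by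
      rcases List.suffix_or_suffix_of_suffix h1 hsu with h | h
      · exact h
      · rcases List.suffix_cons_iff.1 h with h | h
        · rw [h]
        · have := weight_mono ψ (letters_mono h)
          omega
    obtain ⟨p2, a2, e1, e2⟩ := List.exists_eq_append_cons_last (hxs.subset List.mem_cons_self)
    have hs2 : letters s.toList = x ::ₘ letters p2 + letters a2 := by
      rw [e1, letters_append, letters, Multiset.add_cons, Multiset.cons_add]
    refine ⟨erase s, 1, ⟨Or.inr ⟨hxs.subset List.mem_cons_self, rfl⟩, ?_⟩, (letters a2, 0),
      mem_contrib_of_suffix hsu (mem_contrib.2 (Or.inl ⟨a2, ⟨p2, e1.symm⟩, rfl⟩)), ?_, ?_⟩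
    · rintro ⟨k0, hk0, -⟩
      have h3 := (ofWord_mul_of_eq_of hk0).1
      have h4 := coe_erase s.toList
      rw [FreeMonoid.ofList_toList, h3, hs2] at h4
      have h5 : x ∈ x ::ₘ letters p2 + letters a2 := by simp
      rw [← h4] at h5
      simp at h5
    · have h3 := weight_mono ψ (letters_mono (List.last_suffix hxs ⟨p2, e1.symm⟩ e2))
      refine ⟨?_, ?_⟩ <;> simp only [weight_zero] <;> omega
    · rw [upTo_erase_mul_one e1 e2, hs2, zero_add]
  · dsimp only at hd1 hd2
    have hks : .idem k :: s1 <:+ s.toList := by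
      rcases List.suffix_or_suffix_of_suffix h1 hsu with h | h
      · exact h
      · rcases List.suffix_cons_iff.1 h with h | h
        · rw [h]
        -- An occurrence left of the suffix with no heavier right content would be separated from it
        -- by symbols `z⁺` only, contradicting the maximality of the initial block.
        · exfalso
          have h3 := eq_of_le_of_weight_le hψ (letters_mono h) hd1
          obtain ⟨t, rfl⟩ := h
          rw [letters_append, right_eq_add] at h3
          have h4 := isIdem_of_letters_eq_zero h3
          rcases List.eq_nil_or_concat t with rfl | ⟨t', l, rfl⟩
          · exact hmax k h1
          · rw [List.concat_eq_append] at h1 h4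
            cases l with
            | letter y => simpa [ExtLetter.isIdem] using h4 (.letter y) (by simp)
            | idem z =>
              refine hmax z (List.IsSuffix.trans ⟨.idem k :: t', ?_⟩ h1)
              simp
    obtain ⟨p2, a2, e1, e2⟩ := List.exists_eq_append_cons_last (hks.subset List.mem_cons_self)
    have hp := coe_erase_mp e1 e2
    have hs1 : letters s.toList = letters p2 + letters a2 := by
      rw [e1, letters_append]; rfl
    have hp1 : letters (p2 ++ [ExtLetter.idem k]) = letters p2 := by
      rw [letters_append]; exact add_zero _
    rw [hp1] at hp
    have hle := letters_mono (List.last_suffix hks ⟨p2, e1.symm⟩ e2)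
    have h3 := weight_mono ψ hle
    refine ⟨erase (s.mp (.idem k)), k, ⟨Or.inl ⟨k, hks.subset List.mem_cons_self, hxk, rfl⟩, ?_⟩,
      (letters a2, k.upTo x),
      mem_contrib_of_suffix hsu (mem_contrib.2 (Or.inr ⟨k, a2, ⟨p2, e1.symm⟩, hxk, rfl⟩)), ?_, ?_⟩
    -- If this element had been removed from `Q`, then `p` would be empty, the right contents would
    -- agree, and `c` would be the contribution of `w⁺` after all.
    · rintro ⟨k0, hk0, hocc⟩
      obtain ⟨h4, rfl⟩ := ofWord_mul_of_eq_of hk0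
      rw [h4] at hp
      have h5 : letters s.toList = letters a2 := by
        rw [hs1, ← hp]
        exact zero_add _
      rw [← h5] at hle
      refine hne (Prod.ext (eq_of_le_of_weight_le hψ hle hd1).symm (upTo_eq_of_count hocc).symm)
    · refine ⟨?_, ?_⟩ <;> simp only <;> omega
    · rw [FreeMonoid.upTo_of_mul_of_mem _ hxk, hp, hs1]
      dsimp only
      abel

end NonNestedWord

/-! ## The classification -/

namespace NonNestedWord

variable {S : Type*} [DecidableEq S]

/-- Condition on the letters: the last `x` in `u` is followed by some `w⁺` with `x` in `w`, or it
has the same content to its right as the last `x` in `v`. -/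
def LetterCondition (u v : NonNestedWord S) : Prop :=
  ∀ x : S, ExtLetter.letter x ∈ u.supp →
    (∃ w : FreeMonoid S, ExtLetter.idem w ∈ (u.suff (.letter x)).supp ∧ x ∈ w.supp) ∨
    (∀ y : S, (u.suff (.letter x)).occ (.letter y) = (v.suff (.letter x)).occ (.letter y))

/-- Condition on the symbols `w⁺`: the contribution of `x` to `w⁺` is redundant in `u`, or it occurs
in `v`. -/
def IdemCondition (u v : NonNestedWord S) : Prop :=
  ∀ w : FreeMonoid S, ExtLetter.idem w ∈ u.supp → ∀ x : S, x ∈ w.supp →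
    (∀ ψ : FreeMonoid S →* Multiplicative ℕ, ∃ p k : FreeMonoid S,
      NonNestedWord.ofWord p * FreeMonoid.of (ExtLetter.idem k) ∈ u.setR w x ∧
        ψ (w.mp x) ≤ ψ ((p * k).mp x)) ∨
    (∃ h : FreeMonoid S, ExtLetter.idem h ∈ v.supp ∧ ∀ y : S,
      (u.suff (.idem w)).occ (.letter y) = (v.suff (.idem h)).occ (.letter y) ∧
        (w.mp x).occ y = (h.mp x).occ y)

omit [DecidableEq S] in
theorem toAdd_hom_apply (ψ : FreeMonoid S →* Multiplicative ℕ) (w : FreeMonoid S) :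
    Multiplicative.toAdd (ψ w) =
      weight (fun y => Multiplicative.toAdd (ψ (FreeMonoid.of y))) (w.toList : Multiset S) := by
  induction w using FreeMonoid.inductionOn' with
  | one => rw [map_one]; rfl
  | of_mul y w ih =>
    rw [map_mul, toAdd_mul, ih, FreeMonoid.toList_mul, FreeMonoid.toList_of, ← Multiset.coe_add,
      weight_add, Multiset.coe_singleton, weight_singleton]

theorem hom_mp_le_iff (ψ : FreeMonoid S →* Multiplicative ℕ) (w k : FreeMonoid S) (x : S) :
    ψ (w.mp x) ≤ ψ (k.mp x) ↔
      weight (fun y => Multiplicative.toAdd (ψ (FreeMonoid.of y))) (w.upTo x) ≤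
        weight (fun y => Multiplicative.toAdd (ψ (FreeMonoid.of y))) (k.upTo x) := by
  rw [← Multiplicative.toAdd_le, toAdd_hom_apply, toAdd_hom_apply]
  rfl

/-- If no relevant `w⁺` follows the last `x`, every other contribution has more on its right, so the
last `x` is a corner for positive weights. It must then be a corner of `v` too, where the second
component `0` forces it to come from a letter. -/
theorem letterCondition_of_dominated {u v : NonNestedWord S}
    (h : ∀ ψ x, Dominated ψ (contrib x u.toList) (contrib x v.toList) ∧
      Dominated ψ (contrib x v.toList) (contrib x u.toList)) : LetterCondition u v := by
  intro x hx
  obtain ⟨a, ha, ha'⟩ := exists_last_suffix hx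
  have hsu := toList_suff_letter ha ha'
  rw [or_iff_not_imp_left]
  intro hno
  obtain ⟨ψ, hψ, hsep, -⟩ := exists_generic (fun _ => 0)
    (contrib x u.toList ++ contrib x v.toList)
  have hcor : Corner ψ (contrib x u.toList) (letters a, 0) := by
    refine ⟨mem_contrib.2 (Or.inl ⟨a, ha, rfl⟩), fun c hc hd => ?_⟩
    obtain ⟨hd1, -⟩ := hd
    rcases mem_contrib.1 hc with ⟨s, hs, rfl⟩ | ⟨k, s, hs, hk, rfl⟩
    · rw [eq_of_le_of_weight_le hψ (letters_mono (List.last_suffix hs ha ha')) hd1]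
    · exfalso
      rcases List.cons_suffix_trichotomy hs ha with h1 | h1 | ⟨h1, -⟩
      · refine hno ⟨k, ?_, hk⟩
        change _ ∈ (u.suff (.letter x)).toList
        rw [hsu]
        exact List.mem_cons_of_mem _ (h1.subset List.mem_cons_self)
      · have h2 := weight_mono ψ (cons_letters_le h1)
        have h3 := hψ x
        rw [weight_cons] at h2
        simp only at hd1
        omega
      · cases h1
  obtain ⟨hcv, hcor'⟩ := hcor.transfer hsep (h ψ x).1 (h ψ x).2
  rcases mem_contrib.1 hcv with ⟨s, hs, he⟩ | ⟨k, s, hs, hk, he⟩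
  · obtain ⟨b, hb, hb'⟩ := exists_last_suffix (hs.subset List.mem_cons_self)
    have h1 := hcor' _ (mem_contrib.2 (Or.inl ⟨b, hb, rfl⟩)) (by
      rw [he]
      have := weight_mono ψ (letters_mono (List.last_suffix hs hb hb'))
      exact ⟨this, by simpa using this⟩)
    intro y
    have h2 : letters b = letters a := (Prod.ext_iff.1 h1).1
    rw [occ_letter, occ_letter, hsu, toList_suff_letter hb hb', letters, letters, h2]
  · exact absurd (Prod.ext_iff.1 he).2.symm (FreeMonoid.upTo_ne_zero hk)

/-- A `ψ'` for which (a) fails is perturbed to generic weights. No rival in `R` wins for `ψ'`, hence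
none wins after the perturbation, so the contribution is a corner and reappears in `v`. -/
theorem idemCondition_of_dominated {u v : NonNestedWord S}
    (h : ∀ ψ x, Dominated ψ (contrib x u.toList) (contrib x v.toList) ∧
      Dominated ψ (contrib x v.toList) (contrib x u.toList)) : IdemCondition u v := by
  intro w hw x hx
  change x ∈ w.toList at hx
  obtain ⟨a, ha, ha'⟩ := exists_last_suffix hw
  obtain ⟨-, -, hla, -⟩ := suff_idem_spec ha ha'
  rw [or_iff_not_imp_left]
  intro hno
  push Not at hno
  obtain ⟨ψ', hno⟩ := hno
  set ψ₀ : S → ℕ := fun y => Multiplicative.toAdd (ψ' (FreeMonoid.of y)) with hψ₀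
  obtain ⟨ψ, hψ, hsep, hgen⟩ := exists_generic ψ₀ (contrib x u.toList ++ contrib x v.toList)
  set c := (letters (u.suff (.idem w)).toList, w.upTo x) with hc
  have hcu : c ∈ contrib x u.toList := mem_contrib.2 (Or.inr ⟨w, a, ha, hx, by rw [hc, hla]⟩)
  have hcor : Corner ψ (contrib x u.toList) c := by
    refine ⟨hcu, fun c' hc' hd => ?_⟩
    by_contra hne
    obtain ⟨p, k, hR, d, hd1, hd2, heq⟩ := exists_mem_setR_of_dom hw hx hψ hc' hne hd
    obtain ⟨-, hd3⟩ := hgen c (List.mem_append_left _ hcu) d (List.mem_append_left _ hd1) hd2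
    have h1 := hno p k hR
    rw [← not_le, hom_mp_le_iff, ← hψ₀] at h1
    have h2 := congrArg (weight ψ₀) heq
    rw [weight_add, weight_add] at h2
    simp only [hc] at hd3
    exact h1 (by omega)
  obtain ⟨hcv, hcor'⟩ := hcor.transfer hsep (h ψ x).1 (h ψ x).2
  rcases mem_contrib.1 hcv with ⟨s, hs, he⟩ | ⟨k, s, hs, hk, he⟩
  · exact absurd (Prod.ext_iff.1 he).2 (FreeMonoid.upTo_ne_zero hx)
  · obtain ⟨b, hb, hb'⟩ := exists_last_suffix (hs.subset List.mem_cons_self)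
    obtain ⟨-, -, hlb, -⟩ := suff_idem_spec hb hb'
    -- The condition refers to the last `k⁺` in `v`; its contribution dominates that of the
    -- occurrence found, and so equals it by the corner property.
    have h1 := hcor' _ (mem_contrib.2 (Or.inr ⟨k, b, hb, hk, rfl⟩)) (by
      rw [he]
      have := weight_mono ψ (letters_mono (List.last_suffix hs hb hb'))
      exact ⟨this, by simpa using this⟩)
    obtain ⟨h2, h3⟩ := Prod.ext_iff.1 h1
    simp only [hc] at h2 h3
    refine ⟨k, hs.subset List.mem_cons_self, fun y => ⟨?_, ?_⟩⟩
    · rw [occ_letter, occ_letter, hlb, h2]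
    · rw [FreeMonoid.occ_mp, FreeMonoid.occ_mp, h3]

theorem Corner.mem_of_idemCondition {u v : NonNestedWord S} (huv : IdemCondition u v) {ψ : S → ℕ}
    {x : S} {c : Multiset S × Multiset S} (hc : Corner ψ (contrib x u.toList) c)
    (h0 : c.2 ≠ 0) : c ∈ contrib x v.toList := by
  obtain ⟨hcu, hcor⟩ := hc
  rcases mem_contrib.1 hcu with ⟨s, hs, rfl⟩ | ⟨w, s, hs, hx, rfl⟩
  · exact absurd rfl h0
  have hw := hs.subset List.mem_cons_self
  obtain ⟨a, ha, ha'⟩ := exists_last_suffix hw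
  obtain ⟨-, -, hla, -⟩ := suff_idem_spec ha ha'
  have h1 := hcor _ (mem_contrib.2 (Or.inr ⟨w, a, ha, hx, rfl⟩)) (by
    have := weight_mono ψ (letters_mono (List.last_suffix hs ha ha'))
    exact ⟨this, by simpa using this⟩)
  rw [← h1, ← hla] at hcor ⊢
  rcases huv w hw x hx with h | ⟨k, hk, h⟩
  -- Under (a), applied to the given weights, `R` provides a different contribution that dominates
  -- the corner.
  · exfalso
    obtain ⟨p, k, hR, hle⟩ := h
      (FreeMonoid.lift fun y => Multiplicative.ofAdd (ψ y))
    have hψ : (fun y => Multiplicative.toAdd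
        ((FreeMonoid.lift fun y => Multiplicative.ofAdd (ψ y)) (FreeMonoid.of y))) = ψ := by
      funext y
      rw [FreeMonoid.lift_eval_of, toAdd_ofAdd]
    rw [hom_mp_le_iff, hψ] at hle
    obtain ⟨d, hd, hne, hle', heq⟩ := exists_contrib_of_mem_setR hw hx hR
    have h2 := congrArg (weight ψ) heq
    rw [weight_add, weight_add] at h2
    exact hne (hcor d hd ⟨weight_mono ψ hle', by simp only; omega⟩)
  · change ExtLetter.idem k ∈ v.toList at hk
    obtain ⟨b, hb, hb'⟩ := exists_last_suffix hk
    obtain ⟨-, -, hlb, -⟩ := suff_idem_spec hb hb'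
    have h2 : w.upTo x = k.upTo x := upTo_eq_of_count fun y => (h y).2
    have h3 : letters (u.suff (.idem w)).toList = letters (v.suff (.idem k)).toList := by
      ext y
      rw [← occ_letter, ← occ_letter, (h y).1]
    refine mem_contrib.2 (Or.inr ⟨k, b, hb, ?_, by rw [h2, h3, hlb]⟩)
    have h4 := FreeMonoid.mem_upTo hx
    rw [h2] at h4
    exact Multiset.mem_coe.1 (Multiset.mem_of_le (FreeMonoid.upTo_le k x) h4)

theorem Corner.exists_last_letter {u : NonNestedWord S} {ψ : S → ℕ} {x : S}
    {c : Multiset S × Multiset S} (hc : Corner ψ (contrib x u.toList) c) (h0 : c.2 = 0) :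
    ∃ a, .letter x :: a <:+ u.toList ∧ .letter x ∉ a ∧ c = (letters a, 0) := by
  obtain ⟨hcu, hcor⟩ := hc
  rcases mem_contrib.1 hcu with ⟨s, hs, rfl⟩ | ⟨w, s, hs, hx, rfl⟩
  · obtain ⟨a, ha, ha'⟩ := exists_last_suffix (hs.subset List.mem_cons_self)
    refine ⟨a, ha, ha', (hcor _ (mem_contrib.2 (Or.inl ⟨a, ha, rfl⟩)) ?_).symm⟩
    have := weight_mono ψ (letters_mono (List.last_suffix hs ha ha'))
    exact ⟨this, by simpa using this⟩
  · exact absurd h0 (FreeMonoid.upTo_ne_zero hx)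

theorem letters_eq_of_suff_eq {u v : NonNestedWord S} {x : S} {a b : List (ExtLetter S)}
    (ha : .letter x :: a <:+ u.toList) (ha' : .letter x ∉ a)
    (hb : .letter x :: b <:+ v.toList) (hb' : .letter x ∉ b)
    (h : ∀ y : S, (u.suff (.letter x)).occ (.letter y) = (v.suff (.letter x)).occ (.letter y)) :
    letters a = letters b := by
  rw [← Multiset.cons_inj_right x]
  ext y
  have := h y
  rwa [occ_letter, occ_letter, toList_suff_letter ha ha', toList_suff_letter hb hb'] at this

/-- A `w⁺` after the last `x` with `x` in `w` would dominate that `x`. At a corner only alternative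
(b) survives, and it names the matching letter in `v`. -/
theorem Corner.mem_of_letterCondition {u v : NonNestedWord S}
    (hi : letters u.toList = letters v.toList) (huv : LetterCondition u v) {ψ : S → ℕ} {x : S}
    {c : Multiset S × Multiset S} (hc : Corner ψ (contrib x u.toList) c) (h0 : c.2 = 0) :
    c ∈ contrib x v.toList := by
  obtain ⟨a, ha, ha', rfl⟩ := hc.exists_last_letter h0
  have hxu := ha.subset List.mem_cons_self
  have hxv : .letter x ∈ v.toList := by rwa [← mem_letters, ← hi, mem_letters]
  rcases huv x hxu with ⟨w, hw, hxw⟩ | h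
  · exfalso
    change _ ∈ (u.suff (.letter x)).toList at hw
    change x ∈ w.toList at hxw
    rw [toList_suff_letter ha ha'] at hw
    obtain ⟨s, hs, -⟩ := exists_last_suffix (l := .idem w) (u := a) (by simpa using hw)
    have h1 := hc.2 _ (mem_contrib.2 (Or.inr
      ⟨w, s, hs.trans (List.suffix_of_cons_suffix ha), hxw, rfl⟩)) (by
        have := weight_mono ψ (letters_mono (List.suffix_of_cons_suffix hs))
        refine ⟨this, ?_⟩
        simp only [weight_zero]
        omega)
    exact FreeMonoid.upTo_ne_zero hxw (Prod.ext_iff.1 h1).2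
  · obtain ⟨b, hb, hb'⟩ := exists_last_suffix hxv
    refine mem_contrib.2 (Or.inl ⟨b, hb, ?_⟩)
    rw [letters_eq_of_suff_eq ha ha' hb hb' h]

/-- The condition on the letters of `u` also controls those of `v`. -/
theorem Corner.mem_of_letterCondition_symm {u v : NonNestedWord S}
    (hi : letters u.toList = letters v.toList) (huv : LetterCondition u v)
    (huv' : IdemCondition u v) {ψ : S → ℕ} (hψ : ∀ y, 0 < ψ y) {x : S}
    (hsep : Separates ψ (contrib x u.toList)) {c : Multiset S × Multiset S}
    (hc : Corner ψ (contrib x v.toList) c) (h0 : c.2 = 0) : c ∈ contrib x u.toList := by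
  obtain ⟨b, hb, hb', rfl⟩ := hc.exists_last_letter h0
  have hxv := hb.subset List.mem_cons_self
  have hxu : .letter x ∈ u.toList := by rwa [← mem_letters, hi, mem_letters]
  obtain ⟨a, ha, ha'⟩ := exists_last_suffix hxu
  rcases huv x hxu with ⟨w, hw, hxw⟩ | h
  · exfalso
    change _ ∈ (u.suff (.letter x)).toList at hw
    change x ∈ w.toList at hxw
    rw [toList_suff_letter ha ha'] at hw
    obtain ⟨s, hs, -⟩ := exists_last_suffix (l := .idem w) (u := a) (by simpa using hw)
    have hsa := weight_mono ψ (letters_mono (List.suffix_of_cons_suffix hs))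
    -- The given `w⁺` need not have a counterpart in `v`, but a corner above it does. This corner is
    -- not a letter: the last `x` lies to the left of `w⁺` and attains less height.
    obtain ⟨d, hd, hd1, hd2⟩ := exists_corner hsep (mem_contrib.2 (Or.inr
      ⟨w, s, hs.trans (List.suffix_of_cons_suffix ha), hxw, rfl⟩))
    have hpos : 0 < weight ψ (w.upTo x) :=
      lt_of_lt_of_le (hψ x) (le_weight_of_mem ψ (FreeMonoid.mem_upTo hxw))
    simp only at hd1 hd2
    rcases mem_contrib.1 hd.1 with ⟨s', hs', rfl⟩ | ⟨k, s', hs', hxk, rfl⟩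
    · have := weight_mono ψ (letters_mono (List.last_suffix hs' ha ha'))
      simp only [weight_zero] at hd1 hd2
      omega
    · have hk0 := FreeMonoid.upTo_ne_zero hxk
      -- Being to the right of the last `x` is a property of the right content alone, so it carries
      -- over to the occurrence in `v` with the same content. That occurrence then dominates the
      -- last `x` of `v`, contradicting that the latter is a corner.
      have hxs' : x ∉ letters s' := by
        rcases List.cons_suffix_trichotomy hs' ha with h1 | h1 | ⟨h1, -⟩
        · rw [mem_letters]
          exact fun h => ha' ((List.suffix_of_cons_suffix h1).subset h)
        · have h2 := weight_mono ψ (cons_letters_le h1)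
          have h3 := hψ x
          rw [weight_cons] at h2
          simp only at hd1
          omega
        · cases h1
      rcases mem_contrib.1 (hd.mem_of_idemCondition huv' hk0) with
        ⟨t, ht, he⟩ | ⟨k', t, ht, hxk', he⟩
      · exact hk0 (Prod.ext_iff.1 he).2
      · obtain ⟨he1, he2⟩ := Prod.ext_iff.1 he
        simp only at he1 he2
        rcases List.cons_suffix_trichotomy ht hb with h1 | h1 | ⟨h1, -⟩
        · have h2 := hc.2 _ (mem_contrib.2 (Or.inr ⟨k', t, ht, hxk', rfl⟩)) (by
            have := weight_mono ψ (letters_mono (List.suffix_of_cons_suffix h1))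
            refine ⟨this, ?_⟩
            simp only [weight_zero]
            omega)
          exact hk0 (he2.trans (Prod.ext_iff.1 h2).2)
        · rw [he1, mem_letters] at hxs'
          exact hxs' (h1.subset List.mem_cons_self)
        · cases h1
  · refine mem_contrib.2 (Or.inl ⟨a, ha, ?_⟩)
    rw [letters_eq_of_suff_eq ha ha' hb hb' h]

/-- For sufficiency, each contribution is dominated by a corner of its own side for generic weights.
The conditions place that corner on the other side, and genericity brings the domination back to
`ψ₀`. -/
theorem dominated_iff_conditions {u v : NonNestedWord S}
    (hi : letters u.toList = letters v.toList) :
    (∀ ψ x, Dominated ψ (contrib x u.toList) (contrib x v.toList) ∧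
      Dominated ψ (contrib x v.toList) (contrib x u.toList)) ↔
    LetterCondition u v ∧ IdemCondition u v ∧ IdemCondition v u := by
  constructor
  · intro h
    exact ⟨letterCondition_of_dominated h, idemCondition_of_dominated h,
      idemCondition_of_dominated fun ψ x => (h ψ x).symm⟩
  · rintro ⟨h1, h2, h3⟩ ψ₀ x
    obtain ⟨ψ, hψ, hsep, hgen⟩ := exists_generic ψ₀ (contrib x u.toList ++ contrib x v.toList)
    have hsu : Separates ψ (contrib x u.toList) := fun c hc c' hc' =>
      hsep c (List.mem_append_left _ hc) c' (List.mem_append_left _ hc')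
    have hsv : Separates ψ (contrib x v.toList) := fun c hc c' hc' =>
      hsep c (List.mem_append_right _ hc) c' (List.mem_append_right _ hc')
    constructor
    · intro c hc
      obtain ⟨d, hd, hdc⟩ := exists_corner hsu hc
      refine ⟨d, ?_, hgen c (List.mem_append_left _ hc) d (List.mem_append_left _ hd.1) hdc⟩
      by_cases h0 : d.2 = 0
      · exact hd.mem_of_letterCondition hi h1 h0
      · exact hd.mem_of_idemCondition h2 h0
    · intro c hc
      obtain ⟨d, hd, hdc⟩ := exists_corner hsv hc
      refine ⟨d, ?_, hgen c (List.mem_append_right _ hc) d (List.mem_append_right _ hd.1) hdc⟩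
      by_cases h0 : d.2 = 0
      · exact hd.mem_of_letterCondition_symm hi h1 h2 hψ hsu h0
      · exact hd.mem_of_idemCondition h3 h0

theorem satisfiesIdentity_iff {u v : NonNestedWord S} :
    SatisfiesIdentity (FLAd Unit) u.toFreeUnary v.toFreeUnary ↔
      (∀ x : S, u.occ (.letter x) = v.occ (.letter x)) ∧
        LetterCondition u v ∧ IdemCondition u v ∧ IdemCondition v u := by
  have h1 : (∀ x : S, u.occ (.letter x) = v.occ (.letter x)) ↔
      letters u.toList = letters v.toList := by
    simp only [occ_letter, Multiset.ext]
  have h2 := satisfiesIdentity_iff_dominated (u := u.toList) (v := v.toList)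
  rw [FreeMonoid.ofList_toList, FreeMonoid.ofList_toList] at h2
  rw [h2, h1]
  exact and_congr_right fun hi => dominated_iff_conditions hi

end NonNestedWord

/-- Classification of the non-nested enriched identities satisfied by the monogenic free left
adequate monoid (first part), together with the reduction of arbitrary enriched identities to
non-nested ones (second part). -/
theorem mainTheorem3 {S : Type*} [DecidableEq S] :
    (∀ u v : NonNestedWord S,
      SatisfiesIdentity (FLAd Unit) u.toFreeUnary v.toFreeUnary ↔
        -- (i)
        (∀ x : S, u.occ (.letter x) = v.occ (.letter x)) ∧
        -- (ii)
        (∀ x : S, ExtLetter.letter x ∈ u.supp →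
          (∃ w : FreeMonoid S, ExtLetter.idem w ∈ (u.suff (.letter x)).supp ∧ x ∈ w.supp) ∨
          (∀ y : S, (u.suff (.letter x)).occ (.letter y) =
            (v.suff (.letter x)).occ (.letter y))) ∧
        -- (iii)
        (∀ w : FreeMonoid S, ExtLetter.idem w ∈ u.supp → ∀ x : S, x ∈ w.supp →
          (∀ ψ : FreeMonoid S →* Multiplicative ℕ, ∃ p k : FreeMonoid S,
            NonNestedWord.ofWord p * FreeMonoid.of (ExtLetter.idem k) ∈ u.setR w x ∧
              ψ (w.mp x) ≤ ψ ((p * k).mp x)) ∨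
          (∃ h : FreeMonoid S, ExtLetter.idem h ∈ v.supp ∧ ∀ y : S,
            (u.suff (.idem w)).occ (.letter y) = (v.suff (.idem h)).occ (.letter y) ∧
              (w.mp x).occ y = (h.mp x).occ y)) ∧
        -- (iv)
        (∀ w : FreeMonoid S, ExtLetter.idem w ∈ v.supp → ∀ x : S, x ∈ w.supp →
          (∀ ψ : FreeMonoid S →* Multiplicative ℕ, ∃ p k : FreeMonoid S,
            NonNestedWord.ofWord p * FreeMonoid.of (ExtLetter.idem k) ∈ v.setR w x ∧
              ψ (w.mp x) ≤ ψ ((p * k).mp x)) ∨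
          (∃ h : FreeMonoid S, ExtLetter.idem h ∈ u.supp ∧ ∀ y : S,
            (v.suff (.idem w)).occ (.letter y) = (u.suff (.idem h)).occ (.letter y) ∧
              (w.mp x).occ y = (h.mp x).occ y))) ∧
    -- every enriched identity reduces to a non-nested one
    (∀ s : FreeUnaryMonoid S, ∃ u : NonNestedWord S,
      SatisfiesIdentity (FLAd Unit) s u.toFreeUnary) :=
  ⟨fun _ _ => NonNestedWord.satisfiesIdentity_iff, NonNestedWord.exists_nonNested⟩
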